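/- Let $\eta=\frac{1+\sqrt{-7}}2$, so that $\mathbb Z[\eta]$ is the ring of integers of $\mathbb Q(\sqrt{-7})$ (a principal ideal domain with units $\pm1$), and $N(a+b\eta)=a^2+ab+2b^2$. Let $\chi$ be the Hecke Grössencharacter given by $$\chi\big((a+b\eta)\big)=\left(\frac{a^3-2a^2b-ab^2+b^3}{7}\right)(a+b\eta),$$ where $\left(\frac{\cdot}{7}\right)$ is the Legendre symbol. For odd $k\ge1$ put, for $\operatorname{Re}s>1$, $$L(s,\chi^{k})=\frac12\sum_{\substack{(a,b)\in\mathbb Z^2\\(a,b)\neq(0,0)}}\frac{\chi\big((a+b\eta)\big)^{k}}{(a^2+ab+2b^2)^{s+k/2}} ,$$ and let $L(s,\chi^k)$ also denote the continuation of this function to all $s\in\mathbb C$. For every $n\ge1$ the series for $L(s,\chi^{4n-3})$ converges absolutely for $\operatorname{Re}s>1$ and continues to an entire function, and, as $N\to\infty$, $$\frac1N\sum_{n=1}^{N}L\big(\tfrac12,\chi^{4n-3}\big)=\frac{2\pi}{\sqrt7}+O\!\left(\frac{\log N}{\sqrt N}\right).$$ -/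

import Mathlib

open Asymptotics Filter

noncomputable section

instance fact_prime_seven : Fact (Nat.Prime 7) := ⟨by norm_num⟩

namespace HeckeSeven

/-- `η = (1 + √-7) / 2`, so that the ring of integers of `ℚ(√-7)` is `{a + b η : a, b ∈ ℤ}`. -/
def eta : ℂ := (1 + Complex.I * (√7 : ℝ)) / 2

/-- The norm `N(a + b η) = a² + a b + 2 b²`. -/
def nrm (p : ℤ × ℤ) : ℤ := p.1 ^ 2 + p.1 * p.2 + 2 * p.2 ^ 2

/-- The sign `ε_{a,b}`: the residue `±1` of `(a + b η) ^ 3` modulo `√-7`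
(and `0` when `a + b η` is not prime to `√-7`). -/
def eps (p : ℤ × ℤ) : ℤ :=
  legendreSym 7 (p.1 ^ 3 - 2 * p.1 ^ 2 * p.2 - p.1 * p.2 ^ 2 + p.2 ^ 3)

/-- The Hecke Grössencharacter at the ideal generated by `a + b η`. -/
def chi (p : ℤ × ℤ) : ℂ := (eps p : ℂ) * ((p.1 : ℂ) + (p.2 : ℂ) * eta)

/-- The summand of `L(s, χ ^ k)`, analytically normalised (central point `1 / 2`). The factor `1 / 2`
accounts for the two generators `±(a + b η)` of each ideal. -/
def term (k : ℕ) (s : ℂ) (p : ℤ × ℤ) : ℂ :=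
  (1 / 2) * (chi p ^ k / (nrm p : ℂ) ^ (s + (k : ℂ) / 2))

/-- `f` is the entire continuation of the (absolutely convergent for `Re s > 1`) series
`L(s, χ ^ k) = (1 / 2) ∑_{(a, b) ≠ (0, 0)} χ(a + b η) ^ k / N(a + b η) ^ (s + k / 2)`. -/
def IsHeckeL (k : ℕ) (f : ℂ → ℂ) : Prop :=
  Differentiable ℂ f ∧
    ∀ s : ℂ, 1 < s.re → HasSum (fun p : {p : ℤ × ℤ // p ≠ (0, 0)} => term k s p.1) (f s)

/-- There is at most one entire continuation. -/
theorem IsHeckeL.unique {k : ℕ} {f g : ℂ → ℂ} (hf : IsHeckeL k f) (hg : IsHeckeL k g) : f = g := by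
  have hfa : AnalyticOnNhd ℂ f Set.univ := fun z _ => hf.1.analyticAt z
  have hga : AnalyticOnNhd ℂ g Set.univ := fun z _ => hg.1.analyticAt z
  refine hfa.eq_of_eventuallyEq hga (z₀ := 2) ?_
  have h : {s : ℂ | 1 < s.re} ∈ nhds (2 : ℂ) :=
    (isOpen_lt continuous_const Complex.continuous_re).mem_nhds (by norm_num)
  filter_upwards [h] with s hs
  exact (hf.2 s hs).unique (hg.2 s hs)

/-- The Hecke `L`-function `s ↦ L(s, χ ^ k)`: the unique entire function that extends the series
(an unspecified function if there were none). -/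
def heckeL (k : ℕ) : ℂ → ℂ := Classical.epsilon (IsHeckeL k)

/-- The first moment `(1 / N) ∑_{n = 1}^{N} L(1 / 2, χ ^ (4 n - 3))` of the central values. -/
def firstMoment (N : ℕ) : ℂ :=
  (1 / (N : ℂ)) * ∑ n ∈ Finset.Icc 1 N, heckeL (4 * n - 3) (1 / 2)

end HeckeSeven

end

/-!
For odd `k` the Mellin transform of the theta series `∑ ε(λ) λ ^ k exp (-π t N(λ))` over
`λ = a + b η` is essentially `L(s, χ ^ k)`. Modulo `7` the sign `ε(λ)` is the Legendre symbol of
the linear form `a + 4 b`, so Poisson summation in the two coordinates, with the Gauss sum of that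
symbol, gives a functional equation for the generating function of these series, with `exp (u λ)`
in place of `λ ^ k`. Comparing coefficients of powers of `u` gives one for each theta series, whence
the continuation of the `L`-function.

For `k = 4 j + 1` the root number is `1`. Folding the Mellin integral at `1` gives a rapidly
convergent series for `L(1/2, χ ^ k)` over `λ`, in which `λ ^ k / N(λ) ^ (2 j + 1)` is weighted by
an incomplete Gamma function that cuts off at `N(λ)` of order `k`. Its terms with `b = 0` give the
main term `2 π / √7`: without the weight they sum to twice the value at `1` of the Dirichlet series
of the Legendre symbol modulo `7`, evaluated by expanding the symbol in additive characters and
summing their logarithmic series, and the weight costs `O(j ^ (-1/2))` by summation by parts. For a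
fixed `λ` with `b ≠ 0` the terms without their weights form a geometric progression in `j` of ratio
`(λ / conj λ) ^ 2`, which is not `1` unless `ε(λ) = 0`. The weight is monotone in `j`, so summation
by parts bounds the sum over `j < N` by `N(λ) ^ (1/2) / |b (2 a + b)|` for `N(λ)` up to order `N`.
Summing over `λ` gives `O(√N log N)`.
-/

noncomputable section

namespace HeckeSeven

open Complex Finset

/-- The Legendre symbol modulo `p` as a complex Dirichlet character, so that the library's Gauss
sums and discrete Fourier transform apply to it. -/
def legendreChar (p : ℕ) [Fact p.Prime] : DirichletCharacter ℂ p :=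
  (quadraticChar (ZMod p)).ringHomComp (Int.castRingHom ℂ)

theorem legendreChar_intCast (p : ℕ) [Fact p.Prime] (a : ℤ) :
    legendreChar p (a : ZMod p) = (legendreSym p a : ℂ) := rfl

theorem norm_legendreSym_le_one (p : ℕ) [Fact p.Prime] (a : ℤ) : ‖(legendreSym p a : ℂ)‖ ≤ 1 :=
  (legendreChar p).norm_le_one a

theorem legendreSym_pow_of_odd (p : ℕ) [Fact p.Prime] (a : ℤ) {k : ℕ} (hk : Odd k) :
    legendreSym p a ^ k = legendreSym p a := by
  have h := congrArg (· (a : ZMod p)) ((quadraticChar_isQuadratic (ZMod p)).pow_odd hk)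
  rwa [MulChar.pow_apply' _ hk.pos.ne'] at h

theorem legendreSym_add_mul (p : ℕ) [Fact p.Prime] (a q : ℤ) :
    legendreSym p (a + p * q) = legendreSym p a := by
  simp [legendreSym]

theorem legendreSym_seven_neg (a : ℤ) : legendreSym 7 (-a) = -legendreSym 7 a := by
  rw [legendreSym.at_neg (by norm_num), show ZMod.χ₄ (7 : ℕ) = -1 by decide, neg_one_mul]

theorem isQuadratic_legendreChar (p : ℕ) [Fact p.Prime] : (legendreChar p).IsQuadratic :=
  (quadraticChar_isQuadratic (ZMod p)).comp _

theorem legendreChar_ne_one {p : ℕ} [Fact p.Prime] (hp : p ≠ 2) : legendreChar p ≠ 1 :=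
  (MulChar.ringHomComp_ne_one_iff Int.cast_injective).2
    (quadraticChar_ne_one (by rwa [ZMod.ringChar_zmod_n]))

theorem isPrimitive_of_prime {p : ℕ} [Fact p.Prime] {χ : DirichletCharacter ℂ p} (hχ : χ ≠ 1) :
    χ.IsPrimitive :=
  ((Nat.dvd_prime Fact.out).1 χ.conductor_dvd_level).resolve_left fun h =>
    hχ (DirichletCharacter.eq_one_iff_conductor_eq_one.2 h)

theorem gaussSum_legendreChar_seven_im :
    (gaussSum (legendreChar 7) ZMod.stdAddChar).im = 2 * (Real.sin (2 * Real.pi / 7) +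
      Real.sin (4 * Real.pi / 7) - Real.sin (6 * Real.pi / 7)) := by
  have im_term (j : ℤ) : (legendreChar 7 j * ZMod.stdAddChar (j : ZMod 7)).im =
      legendreSym 7 j * Real.sin (2 * Real.pi * j / 7) := by
    rw [legendreChar_intCast, ZMod.stdAddChar_coe, ← ofReal_intCast, im_ofReal_mul,
      show (2 * Real.pi * I * j / (7 : ℕ) : ℂ) = (2 * Real.pi * j / 7 : ℝ) * I by push_cast; ring,
      exp_ofReal_mul_I_im]
  have expand (f : ZMod 7 → ℂ) : ∑ a, f a = f (0 : ℤ) + f (1 : ℤ) + f (2 : ℤ) + f (3 : ℤ) +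
      f (-3 : ℤ) + f (-2 : ℤ) + f (-1 : ℤ) := Fin.sum_univ_seven f
  obtain ⟨h1, h2, h3⟩ : legendreSym 7 1 = 1 ∧ legendreSym 7 2 = 1 ∧ legendreSym 7 3 = -1 := by
    unfold legendreSym
    decide
  rw [gaussSum, expand]
  simp only [add_im, im_term, legendreSym_seven_neg, legendreSym.at_zero, h1, h2, h3]
  push_cast
  simp only [mul_neg, neg_div, Real.sin_neg]
  ring_nf

theorem gaussSum_legendreChar_seven :
    gaussSum (legendreChar 7) ZMod.stdAddChar = I * (√7 : ℝ) := by
  set G := gaussSum (legendreChar 7) ZMod.stdAddChar with hG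
  have G_sq : G ^ 2 = (I * (√7 : ℝ)) ^ 2 := by
    have neg_one : legendreChar 7 (-1) = -1 := by
      have := legendreChar_intCast 7 (-1)
      simpa [legendreSym_seven_neg] using this
    rw [hG, gaussSum_sq (χ := legendreChar 7) (legendreChar_ne_one (by norm_num))
      (isQuadratic_legendreChar 7) (ZMod.isPrimitive_stdAddChar 7), neg_one, mul_pow, I_sq,
      ← ofReal_pow, Real.sq_sqrt (by norm_num), ZMod.card]
    norm_num
  refine (sq_eq_sq_iff_eq_or_eq_neg.1 G_sq).resolve_right fun h => ?_
  have G_im : G.im = -√7 := by rw [h]; simp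
  rw [gaussSum_legendreChar_seven_im] at G_im
  have sin_six : Real.sin (6 * Real.pi / 7) = Real.sin (Real.pi / 7) := by
    rw [← Real.sin_pi_sub]
    ring_nf
  have sin_one_lt : Real.sin (Real.pi / 7) < Real.sin (2 * Real.pi / 7) :=
    Real.sin_lt_sin_of_lt_of_le_pi_div_two (by linarith [Real.pi_pos]) (by linarith [Real.pi_pos])
      (by linarith [Real.pi_pos])
  have sin_four_pos : 0 < Real.sin (4 * Real.pi / 7) :=
    Real.sin_pos_of_pos_of_lt_pi (by positivity) (by linarith [Real.pi_pos])
  linarith [Real.sqrt_nonneg 7]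

theorem dft_legendreChar_seven (a : ZMod 7) :
    ZMod.dft (legendreChar 7) a = -(I * (√7 : ℝ)) * legendreChar 7 a := by
  have hprim := isPrimitive_of_prime (legendreChar_ne_one (p := 7) (by norm_num))
  have hneg : legendreChar 7 (-a) = -legendreChar 7 a := by
    have := legendreSym_seven_neg a.valMinAbs
    have h := congrArg (Int.cast : ℤ → ℂ) this
    push_cast [← legendreChar_intCast, ZMod.coe_valMinAbs] at h
    exact h
  rw [hprim.fourierTransform_eq_inv_mul_gaussSum, (isQuadratic_legendreChar 7).inv, hneg,
    gaussSum_legendreChar_seven]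
  ring

/-! ### Poisson summation for the Legendre symbol -/

theorem tsum_int_eq_sum_zmod {E : Type*} [NormedAddCommGroup E] [CompleteSpace E] {N : ℕ} [NeZero N]
    {F : ℤ → E} (hF : Summable F) :
    ∑' m, F m = ∑ j : ZMod N, ∑' n : ℤ, F (n * N + j.val) := by
  obtain ⟨d, rfl⟩ := Nat.exists_eq_succ_of_ne_zero (NeZero.ne N)
  let e : Fin (d + 1) × ℤ ≃ ℤ := (Equiv.prodComm _ _).trans (Int.divModEquiv (d + 1)).symm
  rw [← e.tsum_eq F, Summable.tsum_prod (f := fun q => F (e q)) (e.summable_iff.2 hF), tsum_fintype]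
  rfl

theorem summable_cexp_quadratic {t : ℝ} (ht : 0 < t) (b : ℂ) :
    Summable fun n : ℤ => cexp (-Real.pi * t * (n : ℂ) ^ 2 + 2 * Real.pi * b * n) := by
  refine ((summable_jacobiTheta₂_term_iff (-I * b) (I * t)).2 (by simpa using ht)).congr fun n => ?_
  rw [jacobiTheta₂_term]
  congr 1
  linear_combination (-(2 * Real.pi * n * b) + Real.pi * n ^ 2 * t) * I_sq

theorem summable_cexp_sq_div_add {t c : ℝ} (ht : 0 < t) (hc : c ≠ 0) (w : ℂ) :
    Summable fun m : ℤ => cexp (-Real.pi / t * ((m : ℂ) / c + I * w) ^ 2) := by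
  have ht' : (t : ℂ) ≠ 0 := ofReal_ne_zero.2 ht.ne'
  have hc' : (c : ℂ) ≠ 0 := ofReal_ne_zero.2 hc
  have hq := (summable_cexp_quadratic (t := 1 / (c ^ 2 * t)) (by positivity)
    (-(I * w / (c * t)))).mul_left (cexp (-Real.pi / t * (I * w) ^ 2))
  refine hq.congr fun m => ?_
  rw [← Complex.exp_add]
  congr 1
  push_cast
  field_simp
  ring

theorem dft_mul_cexp_quadratic {N : ℕ} [NeZero N] (Φ : ZMod N → ℂ) (τ w : ℂ) (a : ℤ) :
    ZMod.dft Φ a * cexp (τ * a ^ 2 + 2 * Real.pi * w * a) =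
      ∑ j : ZMod N, Φ j * cexp (τ * a ^ 2 + 2 * Real.pi * (w - I * (j.val / N)) * a) := by
  rw [ZMod.dft_apply, sum_mul]
  refine sum_congr rfl fun j _ => ?_
  have hchar : ZMod.stdAddChar (-(j * (a : ZMod N))) =
      cexp (2 * Real.pi * I * (-(j.val * a) : ℤ) / N) := by
    rw [← ZMod.stdAddChar_coe]
    simp
  rw [hchar, smul_eq_mul, mul_comm (cexp _), mul_assoc, ← Complex.exp_add]
  congr 2
  push_cast
  ring

theorem tsum_dft_mul_cexp_quadratic {N : ℕ} [NeZero N] (Φ : ZMod N → ℂ) {t : ℝ} (ht : 0 < t)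
    (w : ℂ) :
    ∑' a : ℤ, ZMod.dft Φ a * cexp (-Real.pi * t * (a : ℂ) ^ 2 + 2 * Real.pi * w * a) =
      1 / (t : ℂ) ^ (1 / 2 : ℂ) *
        ∑' m : ℤ, Φ m * cexp (-Real.pi / t * ((m : ℂ) / N + I * w) ^ 2) := by
  have hN : (N : ℝ) ≠ 0 := Nat.cast_ne_zero.2 (NeZero.ne N)
  have hNC : (N : ℂ) ≠ 0 := Nat.cast_ne_zero.2 (NeZero.ne N)
  have shift (j : ZMod N) (n : ℤ) : Φ ((n * N + j.val : ℤ) : ZMod N) *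
      cexp (-Real.pi / t * (((n * N + j.val : ℤ) : ℂ) / N + I * w) ^ 2) =
      Φ j * cexp (-Real.pi / t * (n + I * (w - I * (j.val / N))) ^ 2) := by
    have hcast : ((n * N + j.val : ℤ) : ZMod N) = j := by simp
    rw [hcast]
    congr 4
    push_cast
    field_simp
    linear_combination (j.val : ℂ) * I_sq
  have summable_rhs : Summable fun m : ℤ =>
      Φ m * cexp (-Real.pi / t * ((m : ℂ) / N + I * w) ^ 2) := by
    refine Summable.of_norm_bounded
      ((summable_cexp_sq_div_add ht hN w).norm.mul_left (∑ j, ‖Φ j‖)) fun m => ?_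
    rw [norm_mul, ofReal_natCast]
    gcongr
    exact single_le_sum (f := fun j => ‖Φ j‖) (fun j _ => norm_nonneg _) (mem_univ _)
  simp_rw [dft_mul_cexp_quadratic]
  rw [Summable.tsum_finsetSum fun j _ => (summable_cexp_quadratic ht _).mul_left _,
    tsum_int_eq_sum_zmod (N := N) summable_rhs, mul_sum]
  refine sum_congr rfl fun j _ => ?_
  simp_rw [shift, tsum_mul_left]
  rw [Complex.tsum_exp_neg_quadratic (by simpa using ht)]
  ring

theorem tsum_legendreSym_mul_cexp_quadratic {t : ℝ} (ht : 0 < t) (w : ℂ) :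
    ∑' a : ℤ, (legendreSym 7 a : ℂ) * cexp (-Real.pi * t * (a : ℂ) ^ 2 + 2 * Real.pi * w * a) =
      I / (√7 : ℝ) * (1 / (t : ℂ) ^ (1 / 2 : ℂ)) *
        ∑' m : ℤ, (legendreSym 7 m : ℂ) * cexp (-Real.pi / t * ((m : ℂ) / 7 + I * w) ^ 2) := by
  have h7 : ((√7 : ℝ) : ℂ) ≠ 0 := ofReal_ne_zero.2 (by positivity)
  have h := tsum_dft_mul_cexp_quadratic (legendreChar 7) ht w
  simp_rw [dft_legendreChar_seven, legendreChar_intCast, mul_assoc, tsum_mul_left] at h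
  push_cast at h ⊢
  simp_rw [mul_assoc, ← h]
  generalize ∑' a : ℤ, (legendreSym 7 a : ℂ) * _ = T
  field_simp
  linear_combination T * I_sq

/-! ### The theta functional equation -/

/-- The complex number `a + b η` attached to the coordinates `(a, b)`. -/
def lam (p : ℤ × ℤ) : ℂ := p.1 + p.2 * eta

theorem eps_eq_legendreSym_two_mul_add (p : ℤ × ℤ) : eps p = legendreSym 7 (2 * p.1 + p.2) := by
  have h : ∀ a b : ZMod 7, quadraticChar (ZMod 7) (a ^ 3 - 2 * a ^ 2 * b - a * b ^ 2 + b ^ 3) =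
      quadraticChar (ZMod 7) (2 * a + b) := by decide
  simpa [eps, legendreSym] using h p.1 p.2

theorem eps_eq_legendreSym_add_four_mul (p : ℤ × ℤ) : eps p = legendreSym 7 (p.1 + 4 * p.2) := by
  have h : ∀ a b : ZMod 7, quadraticChar (ZMod 7) (a ^ 3 - 2 * a ^ 2 * b - a * b ^ 2 + b ^ 3) =
      quadraticChar (ZMod 7) (a + 4 * b) := by decide
  simpa [eps, legendreSym] using h p.1 p.2

theorem eps_zero : eps (0, 0) = 0 := by simp [eps]

theorem norm_eps_le_one (p : ℤ × ℤ) : ‖(eps p : ℂ)‖ ≤ 1 := norm_legendreSym_le_one 7 _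

theorem lam_re (p : ℤ × ℤ) : (lam p).re = (2 * p.1 + p.2) / 2 := by
  simp [lam, eta]
  ring

theorem lam_im (p : ℤ × ℤ) : (lam p).im = √7 * p.2 / 2 := by
  simp [lam, eta]
  ring

theorem norm_lam_sq (p : ℤ × ℤ) : ‖lam p‖ ^ 2 = nrm p := by
  have h7 : √7 * √7 = (7 : ℝ) := Real.mul_self_sqrt (by norm_num)
  rw [← normSq_eq_norm_sq, normSq_apply, lam_re, lam_im, nrm]
  push_cast
  linear_combination ((p.2 : ℝ) ^ 2 / 4) * h7

theorem nrm_nonneg (p : ℤ × ℤ) : 0 ≤ nrm p := by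
  have h : (0 : ℝ) ≤ nrm p := norm_lam_sq p ▸ sq_nonneg _
  exact_mod_cast h

theorem lam_eq_zero_iff {p : ℤ × ℤ} : lam p = 0 ↔ p = (0, 0) := by
  refine ⟨fun h => ?_, fun h => by simp [h, lam]⟩
  have hb : p.2 = 0 := by simpa [lam_im] using congrArg im h
  have ha : p.1 = 0 := by simpa [lam_re, hb] using congrArg re h
  exact Prod.ext ha hb

theorem nrm_pos {p : ℤ × ℤ} (hp : p ≠ (0, 0)) : 0 < nrm p := by
  have h : (0 : ℝ) < nrm p := by
    rw [← norm_lam_sq]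
    exact pow_pos (norm_pos_iff.2 (lam_eq_zero_iff.not.2 hp)) 2
  exact_mod_cast h

theorem add_sq_div_two_le_nrm (p : ℤ × ℤ) : ((p.1 : ℝ) ^ 2 + (p.2 : ℝ) ^ 2) / 2 ≤ nrm p := by
  rw [nrm]
  push_cast
  nlinarith [sq_nonneg ((p.1 : ℝ) + p.2), sq_nonneg (p.2 : ℝ)]

theorem summable_exp_neg_mul_sq {c : ℝ} (hc : 0 < c) :
    Summable fun n : ℤ => Real.exp (-c * (n : ℝ) ^ 2) := by
  have h := (summable_cexp_quadratic (t := c / Real.pi) (by positivity) 0).norm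
  refine h.congr fun n => ?_
  rw [Complex.norm_exp]
  congr 1
  have hpi : (Real.pi : ℂ) ≠ 0 := ofReal_ne_zero.2 Real.pi_ne_zero
  rw [show (-Real.pi * (c / Real.pi : ℝ) * (n : ℂ) ^ 2 + 2 * Real.pi * 0 * n : ℂ) =
    ((-c * (n : ℝ) ^ 2 : ℝ) : ℂ) by push_cast; field_simp; ring, ofReal_re]

theorem summable_exp_neg_mul_nrm {c : ℝ} (hc : 0 < c) :
    Summable fun p : ℤ × ℤ => Real.exp (-c * nrm p) := by
  have h := summable_exp_neg_mul_sq (half_pos hc)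
  refine Summable.of_nonneg_of_le (fun _ => (Real.exp_pos _).le) (fun p => ?_)
    (h.mul_of_nonneg h (fun _ => (Real.exp_pos _).le) fun _ => (Real.exp_pos _).le)
  rw [← Real.exp_add, Real.exp_le_exp]
  nlinarith [add_sq_div_two_le_nrm p]

theorem neg_mul_nrm_add_mul_norm_lam_le {c : ℝ} (hc : 0 < c) (v : ℝ) (p : ℤ × ℤ) :
    -(c * nrm p) + v * ‖lam p‖ ≤ v ^ 2 / (2 * c) + -(c / 2) * nrm p := by
  have h : v ^ 2 / (2 * c) - v * ‖lam p‖ + c / 2 * ‖lam p‖ ^ 2 =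
      (v - c * ‖lam p‖) ^ 2 / (2 * c) := by
    field_simp
    ring
  have hsq : 0 ≤ (v - c * ‖lam p‖) ^ 2 / (2 * c) := by positivity
  rw [← norm_lam_sq]
  linarith

theorem summable_exp_neg_mul_nrm_mul_exp_norm_lam {c : ℝ} (hc : 0 < c) (v : ℝ) :
    Summable fun p : ℤ × ℤ => Real.exp (-(c * nrm p)) * Real.exp (v * ‖lam p‖) := by
  refine Summable.of_nonneg_of_le (fun _ => by positivity) (fun p => ?_)
    ((summable_exp_neg_mul_nrm (half_pos hc)).mul_left (Real.exp (v ^ 2 / (2 * c))))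
  rw [← Real.exp_add, ← Real.exp_add, Real.exp_le_exp]
  exact neg_mul_nrm_add_mul_norm_lam_le hc v p

/-- The summand of the two-variable theta series `theta`. -/
def thetaTerm (t : ℝ) (u : ℂ) (p : ℤ × ℤ) : ℂ :=
  eps p * cexp (-(Real.pi * t * nrm p) + u * lam p)

/-- The two-variable theta series `∑ ε(λ) exp (-π t N(λ) + u λ)`, the generating function in `u` of
the theta series `thetaPow k` attached to the powers of the Grössencharacter. -/
def theta (t : ℝ) (u : ℂ) : ℂ := ∑' p, thetaTerm t u p

theorem thetaTerm_eq_mul_exp (t : ℝ) (u : ℂ) (p : ℤ × ℤ) :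
    thetaTerm t u p = eps p * Real.exp (-(Real.pi * t * nrm p)) * cexp (u * lam p) := by
  rw [thetaTerm, Complex.exp_add, ← mul_assoc]
  push_cast
  rfl

theorem norm_eps_mul_exp_le (x : ℝ) (p : ℤ × ℤ) : ‖(eps p * Real.exp x : ℂ)‖ ≤ Real.exp x := by
  rw [norm_mul, norm_real, Real.norm_of_nonneg (Real.exp_pos _).le]
  exact mul_le_of_le_one_left (Real.exp_pos _).le (norm_eps_le_one p)

theorem summable_thetaTerm {t : ℝ} (ht : 0 < t) (u : ℂ) : Summable (thetaTerm t u) := by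
  refine Summable.of_norm_bounded
    (summable_exp_neg_mul_nrm_mul_exp_norm_lam (mul_pos Real.pi_pos ht) ‖u‖) fun p => ?_
  rw [thetaTerm_eq_mul_exp, norm_mul]
  gcongr
  · exact norm_eps_mul_exp_le _ p
  · rw [← norm_mul]
    exact norm_exp_le_exp_norm _

/-- The summand obtained from `thetaTerm` by Poisson summation in one of the two variables: `m` is
dual to `a + 4 b`, while `b` is still the original coordinate. -/
def mixedThetaTerm (t : ℝ) (u : ℂ) (m b : ℤ) : ℂ :=
  legendreSym 7 m * cexp (-Real.pi / t * ((m : ℂ) / 7 + I * (u / (2 * Real.pi))) ^ 2) *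
    cexp (-Real.pi * (7 * t / 4 : ℝ) * (b : ℂ) ^ 2 +
      2 * Real.pi * (I * (√7 : ℝ) * u / (4 * Real.pi) - I * m / 2) * b)

theorem sq_ofReal_sqrt_seven : ((√7 : ℝ) : ℂ) ^ 2 = 7 := by
  rw [← ofReal_pow, Real.sq_sqrt (by norm_num)]
  norm_num

theorem tsum_thetaTerm_sub_four_mul {t : ℝ} (ht : 0 < t) (u : ℂ) (b : ℤ) :
    ∑' a : ℤ, thetaTerm t u (a - 4 * b, b) =
      I / (√7 : ℝ) * (1 / (t : ℂ) ^ (1 / 2 : ℂ)) * ∑' m : ℤ, mixedThetaTerm t u m b := by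
  have ht0 : (t : ℂ) ≠ 0 := ofReal_ne_zero.2 ht.ne'
  have hpi : (Real.pi : ℂ) ≠ 0 := ofReal_ne_zero.2 Real.pi_ne_zero
  let w : ℂ := 7 * t * b / 2 + u / (2 * Real.pi)
  let Q : ℂ := cexp (-(14 * Real.pi * t * b ^ 2) + u * (-7 / 2 + I * (√7 : ℝ) / 2) * b)
  have factor_theta (a : ℤ) : thetaTerm t u (a - 4 * b, b) =
      Q * (legendreSym 7 a * cexp (-Real.pi * t * (a : ℂ) ^ 2 + 2 * Real.pi * w * a)) := by
    rw [thetaTerm, eps_eq_legendreSym_add_four_mul, mul_left_comm, ← Complex.exp_add,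
      sub_add_cancel]
    congr 2
    simp only [w, nrm, lam, eta]
    push_cast
    field_simp
    ring
  have factor_mixed (m : ℤ) : mixedThetaTerm t u m b =
      Q * (legendreSym 7 m * cexp (-Real.pi / t * ((m : ℂ) / 7 + I * w) ^ 2)) := by
    rw [mixedThetaTerm, mul_left_comm, ← Complex.exp_add, mul_assoc, ← Complex.exp_add]
    congr 2
    simp only [w]
    push_cast
    field_simp
    ring_nf
    simp only [I_sq]
    ring
  simp_rw [factor_theta, factor_mixed, tsum_mul_left, tsum_legendreSym_mul_cexp_quadratic ht]
  ring

theorem summable_mixedThetaTerm {t : ℝ} (ht : 0 < t) (u : ℂ) :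
    Summable fun q : ℤ × ℤ => mixedThetaTerm t u q.1 q.2 := by
  have norm_second (m b : ℤ) : ‖cexp (-Real.pi * (7 * t / 4 : ℝ) * (b : ℂ) ^ 2 +
      2 * Real.pi * (I * (√7 : ℝ) * u / (4 * Real.pi) - I * m / 2) * b)‖ =
      ‖cexp (-Real.pi * (7 * t / 4 : ℝ) * (b : ℂ) ^ 2 +
        2 * Real.pi * (I * (√7 : ℝ) * u / (4 * Real.pi)) * b)‖ := by
    rw [Complex.norm_exp, Complex.norm_exp]
    congr 1
    simp
  have summable_first := (summable_cexp_sq_div_add ht (c := 7) (by norm_num)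
    (u / (2 * Real.pi))).norm
  have summable_second := (summable_cexp_quadratic (t := 7 * t / 4) (by positivity)
    (I * (√7 : ℝ) * u / (4 * Real.pi))).norm
  refine Summable.of_norm_bounded (summable_first.mul_of_nonneg summable_second
    (fun _ => norm_nonneg _) fun _ => norm_nonneg _) fun q => ?_
  rw [mixedThetaTerm, norm_mul, norm_mul, norm_second, ofReal_ofNat]
  gcongr
  exact mul_le_of_le_one_left (norm_nonneg _) (norm_legendreSym_le_one 7 _)

theorem tsum_mixedThetaTerm {t : ℝ} (ht : 0 < t) (u : ℂ) (m : ℤ) :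
    ∑' b : ℤ, mixedThetaTerm t u m b = 1 / ((7 * t / 4 : ℝ) : ℂ) ^ (1 / 2 : ℂ) *
      ∑' n : ℤ, thetaTerm (4 / (49 * t)) (-2 * I * u / (7 * t)) (-n, 2 * n + m) := by
  have ht0 : (t : ℂ) ≠ 0 := ofReal_ne_zero.2 ht.ne'
  have hpi : (Real.pi : ℂ) ≠ 0 := ofReal_ne_zero.2 Real.pi_ne_zero
  have factor (n : ℤ) : thetaTerm (4 / (49 * t)) (-2 * I * u / (7 * t)) (-n, 2 * n + m) =
      legendreSym 7 m * cexp (-Real.pi / t * ((m : ℂ) / 7 + I * (u / (2 * Real.pi))) ^ 2) *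
        cexp (-Real.pi / (7 * t / 4 : ℝ) *
          (n + I * (I * (√7 : ℝ) * u / (4 * Real.pi) - I * m / 2)) ^ 2) := by
    rw [thetaTerm, eps_eq_legendreSym_two_mul_add, mul_assoc (legendreSym 7 m : ℂ),
      ← Complex.exp_add, show 2 * -n + (2 * n + m) = m by ring]
    congr 2
    simp only [nrm, lam, eta]
    push_cast
    field_simp
    ring_nf
    simp only [I_sq, sq_ofReal_sqrt_seven, I_pow_four]
    ring
  simp_rw [factor, mixedThetaTerm, tsum_mul_left]
  rw [Complex.tsum_exp_neg_quadratic (by rw [ofReal_re]; positivity)]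
  ring

theorem cpow_half_eq_sqrt {x : ℝ} (hx : 0 ≤ x) : (x : ℂ) ^ (1 / 2 : ℂ) = (√x : ℝ) := by
  rw [Real.sqrt_eq_rpow, ofReal_cpow hx]
  norm_num

theorem poisson_constant_mul {t : ℝ} (ht : 0 < t) :
    I / (√7 : ℝ) * (1 / (t : ℂ) ^ (1 / 2 : ℂ)) * (1 / ((7 * t / 4 : ℝ) : ℂ) ^ (1 / 2 : ℂ)) =
      2 * I / (7 * t) := by
  have hsqrt : √(7 * t / 4) = √7 * √t / 2 := by
    rw [Real.sqrt_div (by positivity), Real.sqrt_mul (by norm_num),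
      show (4 : ℝ) = 2 ^ 2 by norm_num, Real.sqrt_sq (by norm_num)]
  have hsq : ((√t : ℝ) : ℂ) ^ 2 = t := by rw [← ofReal_pow, Real.sq_sqrt ht.le]
  have ht0 : (t : ℂ) ≠ 0 := ofReal_ne_zero.2 ht.ne'
  have h0 : ((√t : ℝ) : ℂ) ≠ 0 := ofReal_ne_zero.2 (by positivity)
  have h7 : ((√7 : ℝ) : ℂ) ≠ 0 := ofReal_ne_zero.2 (by positivity)
  rw [cpow_half_eq_sqrt ht.le, cpow_half_eq_sqrt (by positivity), hsqrt]
  push_cast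
  field_simp
  rw [hsq, sq_ofReal_sqrt_seven]

theorem theta_functional_equation {t : ℝ} (ht : 0 < t) (u : ℂ) :
    theta t u = 2 * I / (7 * t) * theta (4 / (49 * t)) (-2 * I * u / (7 * t)) := by
  let e : ℤ × ℤ ≃ ℤ × ℤ :=
    ⟨fun q => (q.2 - 4 * q.1, q.1), fun p => (p.2, p.1 + 4 * p.2), fun q => by simp,
      fun p => by simp⟩
  let e' : ℤ × ℤ ≃ ℤ × ℤ :=
    ⟨fun q => (-q.2, 2 * q.2 + q.1), fun p => (2 * p.1 + p.2, -p.1), fun q => by simp,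
      fun p => by simp⟩
  have summable_e : Summable fun q => thetaTerm t u (e q) :=
    e.summable_iff.2 (summable_thetaTerm ht u)
  have summable_e' : Summable fun q => thetaTerm (4 / (49 * t)) (-2 * I * u / (7 * t)) (e' q) :=
    e'.summable_iff.2 (summable_thetaTerm (by positivity) _)
  calc theta t u = ∑' b : ℤ, ∑' a : ℤ, thetaTerm t u (a - 4 * b, b) := by
        rw [theta, ← e.tsum_eq, summable_e.tsum_prod]
        rfl
    _ = I / (√7 : ℝ) * (1 / (t : ℂ) ^ (1 / 2 : ℂ)) *
          ∑' m : ℤ, ∑' b : ℤ, mixedThetaTerm t u m b := by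
        simp_rw [tsum_thetaTerm_sub_four_mul ht, tsum_mul_left]
        rw [Summable.tsum_comm (f := mixedThetaTerm t u) (summable_mixedThetaTerm ht u)]
    _ = 2 * I / (7 * t) *
          ∑' m : ℤ, ∑' n : ℤ, thetaTerm (4 / (49 * t)) (-2 * I * u / (7 * t)) (-n, 2 * n + m) := by
        simp_rw [tsum_mixedThetaTerm ht, tsum_mul_left]
        rw [← mul_assoc, poisson_constant_mul ht]
    _ = 2 * I / (7 * t) * theta (4 / (49 * t)) (-2 * I * u / (7 * t)) := by
        rw [theta, ← e'.tsum_eq, summable_e'.tsum_prod]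
        rfl

theorem hasSum_pow_mul_tsum_div_factorial {ι : Type*} {c l : ι → ℂ} {u : ℂ}
    (h : Summable fun i => ‖c i‖ * Real.exp (‖u‖ * ‖l i‖)) :
    HasSum (fun k : ℕ => u ^ k * ((∑' i, c i * l i ^ k) / k.factorial))
      (∑' i, c i * cexp (u * l i)) := by
  let F : ι × ℕ → ℂ := fun q => c q.1 * ((u * l q.1) ^ q.2 / q.2.factorial)
  have hasSum_F (i : ι) : HasSum (fun k => F (i, k)) (c i * cexp (u * l i)) := by
    rw [Complex.exp_eq_exp_ℂ]
    exact (NormedSpace.expSeries_div_hasSum_exp (u * l i)).mul_left (c i)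
  have hasSum_norm_F (i : ι) : HasSum (fun k => ‖F (i, k)‖) (‖c i‖ * Real.exp (‖u‖ * ‖l i‖)) := by
    rw [Real.exp_eq_exp_ℝ]
    simpa [F] using (NormedSpace.expSeries_div_hasSum_exp (‖u‖ * ‖l i‖)).mul_left ‖c i‖
  have summable_F : Summable F := by
    refine Summable.of_norm ((summable_prod_of_nonneg fun q => norm_nonneg _).2
      ⟨fun i => (hasSum_norm_F i).summable, h.congr fun i => ((hasSum_norm_F i).tsum_eq).symm⟩)
  have hsum := summable_F.prod_symm.hasSum.prod_fiberwise
    fun k => (summable_F.prod_symm.prod_factor k).hasSum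
  have htotal : ∑' q, F (Prod.swap q) = ∑' i, c i * cexp (u * l i) := by
    refine ((Equiv.prodComm ℕ ι).tsum_eq F).trans ?_
    rw [summable_F.tsum_prod]
    exact tsum_congr fun i => (hasSum_F i).tsum_eq
  rw [htotal] at hsum
  refine hsum.congr_fun fun k => ?_
  rw [← tsum_div_const, ← tsum_mul_left]
  refine tsum_congr fun i => ?_
  simp only [F, Prod.swap, mul_pow]
  ring

theorem coeff_eq_of_hasSum_pow_mul {a b : ℕ → ℂ} {f : ℂ → ℂ}
    (ha : ∀ u, HasSum (fun k => u ^ k * a k) (f u))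
    (hb : ∀ u, HasSum (fun k => u ^ k * b k) (f u)) : a = b := by
  have hasFPowerSeries (c : ℕ → ℂ) (hc : ∀ u, HasSum (fun k => u ^ k * c k) (f u)) :
      HasFPowerSeriesAt f (FormalMultilinearSeries.ofScalars ℂ c) 0 := by
    rw [hasFPowerSeriesAt_iff]
    exact Filter.Eventually.of_forall fun z => by simpa using hc z
  have h := (hasFPowerSeries a ha).eq_formalMultilinearSeries (hasFPowerSeries b hb)
  funext k
  simpa using congrArg (FormalMultilinearSeries.coeff · k) h

/-- The one-variable theta series `∑ ε(λ) λ ^ k exp (-π t N(λ))`, whose Mellin transform is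
essentially `L(s, χ ^ k)` for odd `k`. -/
def thetaPow (k : ℕ) (t : ℝ) : ℂ :=
  ∑' p : ℤ × ℤ, eps p * lam p ^ k * Real.exp (-(Real.pi * t * nrm p))

theorem hasSum_theta {t : ℝ} (ht : 0 < t) (u : ℂ) :
    HasSum (fun k : ℕ => u ^ k * (thetaPow k t / k.factorial)) (theta t u) := by
  have hsum : Summable fun p => ‖(eps p * Real.exp (-(Real.pi * t * nrm p)) : ℂ)‖ *
      Real.exp (‖u‖ * ‖lam p‖) := by
    refine Summable.of_nonneg_of_le (fun _ => by positivity) (fun p => ?_)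
      (summable_exp_neg_mul_nrm_mul_exp_norm_lam (mul_pos Real.pi_pos ht) ‖u‖)
    gcongr
    exact norm_eps_mul_exp_le _ p
  simpa only [theta, thetaPow, thetaTerm_eq_mul_exp, mul_right_comm] using
    hasSum_pow_mul_tsum_div_factorial hsum

theorem thetaPow_functional_equation {t : ℝ} (ht : 0 < t) (k : ℕ) :
    thetaPow k t = 2 * I / (7 * t) * (-2 * I / (7 * t)) ^ k * thetaPow k (4 / (49 * t)) := by
  have hcoeff := coeff_eq_of_hasSum_pow_mul (hasSum_theta ht)
    (b := fun k => 2 * I / (7 * t) * (-2 * I / (7 * t)) ^ k * thetaPow k (4 / (49 * t)) /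
      k.factorial) fun u => by
    rw [theta_functional_equation ht u]
    refine ((hasSum_theta (by positivity) _).mul_left _).congr_fun fun k => ?_
    rw [mul_div_right_comm (-2 * I) u, mul_pow]
    ring
  exact (div_left_inj' (Nat.cast_ne_zero.2 k.factorial_ne_zero)).1 (congrFun hcoeff k)

/-! ### Entire continuation -/

theorem norm_eps_mul_lam_pow_mul_exp_le (k : ℕ) (t : ℝ) (p : ℤ × ℤ) :
    ‖(eps p * lam p ^ k * Real.exp (-(Real.pi * t * nrm p)) : ℂ)‖ ≤
      k.factorial * (Real.exp (-(Real.pi * t * nrm p)) * Real.exp (1 * ‖lam p‖)) := by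
  have norm_pow_le : ‖lam p‖ ^ k ≤ k.factorial * Real.exp ‖lam p‖ := by
    have := Real.pow_div_factorial_le_exp ‖lam p‖ (norm_nonneg _) k
    rwa [div_le_iff₀' (by positivity)] at this
  rw [mul_right_comm, norm_mul, norm_pow, one_mul, mul_left_comm]
  gcongr
  exact norm_eps_mul_exp_le _ p

theorem summable_eps_mul_lam_pow_mul_exp (k : ℕ) {t : ℝ} (ht : 0 < t) :
    Summable fun p => (eps p * lam p ^ k * Real.exp (-(Real.pi * t * nrm p)) : ℂ) :=
  Summable.of_norm_bounded ((summable_exp_neg_mul_nrm_mul_exp_norm_lam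
    (mul_pos Real.pi_pos ht) 1).mul_left _) (norm_eps_mul_lam_pow_mul_exp_le k t)

/-- The theta series `thetaPow k`, rescaled so that its functional equation relates `x` and
`1 / x`. -/
def heckeTheta (k : ℕ) (x : ℝ) : ℂ := thetaPow k (2 * x / 7)

theorem heckeTheta_one_div (k : ℕ) {x : ℝ} (hx : 0 < x) :
    heckeTheta k (1 / x) = I * (-I) ^ k * (x : ℂ) ^ (k + 1) * heckeTheta k x := by
  have hx0 : (x : ℂ) ≠ 0 := ofReal_ne_zero.2 hx.ne'
  rw [heckeTheta, thetaPow_functional_equation (by positivity), heckeTheta,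
    show 4 / (49 * (2 * (1 / x) / 7)) = 2 * x / 7 by field_simp; ring]
  push_cast
  rw [show 2 * I / (7 * (2 * (1 / (x : ℂ)) / 7)) = I * x by field_simp,
    show -2 * I / (7 * (2 * (1 / (x : ℂ)) / 7)) = -I * x by field_simp]
  ring

theorem hasSum_heckeTheta (k : ℕ) {x : ℝ} (hx : 0 < x) :
    HasSum (fun p => eps p * lam p ^ k * Real.exp (-(2 * Real.pi / 7 * nrm p) * x))
      (heckeTheta k x) := by
  refine (summable_eps_mul_lam_pow_mul_exp k (by positivity)).hasSum.congr_fun fun p => ?_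
  ring_nf

theorem continuousOn_heckeTheta (k : ℕ) : ContinuousOn (heckeTheta k) (Set.Ioi 0) := by
  intro x (hx : 0 < x)
  have h : ContinuousOn (heckeTheta k) (Set.Ioi (x / 2)) := by
    refine continuousOn_tsum (fun p => by fun_prop)
      ((summable_exp_neg_mul_nrm_mul_exp_norm_lam (c := Real.pi * (x / 7)) (by positivity)
        1).mul_left (k.factorial : ℝ))
      fun p y (hy : x / 2 < y) => (norm_eps_mul_lam_pow_mul_exp_le k _ p).trans ?_
    have hN : (0 : ℝ) ≤ nrm p := Int.cast_nonneg (nrm_nonneg p)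
    gcongr
    linarith
  exact (h.continuousAt (Ioi_mem_nhds (by linarith))).continuousWithinAt

theorem one_le_nrm {p : ℤ × ℤ} (hp : p ≠ (0, 0)) : (1 : ℝ) ≤ nrm p := by
  exact_mod_cast nrm_pos hp

theorem exists_norm_heckeTheta_le (k : ℕ) : ∃ C : ℝ, ∀ x : ℝ, 1 ≤ x →
    ‖heckeTheta k x‖ ≤ C * Real.exp (-(Real.pi / 7) * x) := by
  have hsum := (summable_exp_neg_mul_nrm_mul_exp_norm_lam (c := Real.pi / 7) (by positivity)
    1).mul_left (k.factorial : ℝ)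
  refine ⟨_, fun x hx => tsum_of_norm_bounded
    (hsum.hasSum.mul_right (Real.exp (-(Real.pi / 7) * x))) fun p => ?_⟩
  rcases eq_or_ne p (0, 0) with rfl | hp
  · rw [eps_zero]
    simp only [Int.cast_zero, zero_mul, norm_zero]
    positivity
  refine (norm_eps_mul_lam_pow_mul_exp_le k _ p).trans ?_
  have hN : x + nrm p ≤ 2 * x * nrm p := by nlinarith [one_le_nrm hp]
  have hexp : Real.exp (-(Real.pi * (2 * x / 7) * nrm p)) ≤
      Real.exp (-(Real.pi / 7 * nrm p)) * Real.exp (-(Real.pi / 7) * x) := by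
    rw [← Real.exp_add, Real.exp_le_exp]
    nlinarith [mul_le_mul_of_nonneg_left hN Real.pi_pos.le]
  rw [mul_assoc (k.factorial : ℝ) (_ * _), mul_right_comm (Real.exp (-(Real.pi / 7 * nrm p)))]
  gcongr

theorem heckeTheta_isBigO_rpow (k : ℕ) (r : ℝ) :
    heckeTheta k =O[atTop] fun x : ℝ => x ^ r := by
  obtain ⟨C, hC⟩ := exists_norm_heckeTheta_le k
  refine IsBigO.trans (IsBigO.of_bound C ?_)
    (isLittleO_exp_neg_mul_rpow_atTop (a := Real.pi / 7) (by positivity) r).isBigO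
  filter_upwards [eventually_ge_atTop 1] with x hx
  rw [Real.norm_of_nonneg (Real.exp_pos _).le]
  exact hC x hx

/-- The functional equation of `heckeTheta k`, in the form consumed by the library's theory of
Mellin transforms. -/
def heckePair (k : ℕ) : WeakFEPair ℂ where
  f := heckeTheta k
  g := heckeTheta k
  k := (k + 1 : ℕ)
  ε := I * (-I) ^ k
  f₀ := 0
  g₀ := 0
  hf_int := (continuousOn_heckeTheta k).locallyIntegrableOn measurableSet_Ioi
  hg_int := (continuousOn_heckeTheta k).locallyIntegrableOn measurableSet_Ioi
  hk := by positivity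
  hε := mul_ne_zero I_ne_zero (pow_ne_zero _ (neg_ne_zero.2 I_ne_zero))
  h_feq x hx := by
    rw [heckeTheta_one_div k hx, Real.rpow_natCast, smul_eq_mul, ofReal_pow]
  hf_top r := by simpa only [sub_zero] using heckeTheta_isBigO_rpow k r
  hg_top r := by simpa only [sub_zero] using heckeTheta_isBigO_rpow k r

theorem isStrongFEPair_heckePair (k : ℕ) : IsStrongFEPair (heckePair k) := ⟨rfl, rfl⟩

theorem differentiable_mellin_heckeTheta (k : ℕ) : Differentiable ℂ (mellin (heckeTheta k)) :=
  (isStrongFEPair_heckePair k).Λ_eq ▸ (isStrongFEPair_heckePair k).differentiable_Λ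

theorem mellinConvergent_heckeTheta (k : ℕ) (s : ℂ) : MellinConvergent (heckeTheta k) s :=
  ((isStrongFEPair_heckePair k).hasMellin s).1

theorem summable_one_div_norm_rpow_int_prod {r : ℝ} (hr : 2 < r) :
    Summable fun p : ℤ × ℤ => ‖p‖ ^ (-r) := by
  refine ((finTwoArrowEquiv ℤ).symm.summable_iff.2
    (EisensteinSeries.summable_one_div_norm_rpow hr)).congr fun p => ?_
  simp [Prod.norm_def, EisensteinSeries.norm_eq_max_natAbs, Int.norm_eq_abs]

theorem nrm_rpow_neg_le {σ : ℝ} (hσ : 0 < σ) (p : ℤ × ℤ) :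
    (nrm p : ℝ) ^ (-σ) ≤ 2 ^ σ * ‖p‖ ^ (-(2 * σ)) := by
  rcases eq_or_ne p (0, 0) with rfl | hp
  · rw [show (nrm (0, 0) : ℝ) = 0 by simp [nrm], Real.zero_rpow (by linarith)]
    positivity
  have norm_p_pos : 0 < ‖p‖ := norm_pos_iff.2 hp
  have norm_p_sq_le : ‖p‖ ^ 2 / 2 ≤ nrm p := by
    refine le_trans ?_ (add_sq_div_two_le_nrm p)
    rw [Prod.norm_def, Int.norm_eq_abs, Int.norm_eq_abs]
    rcases max_choice |(p.1 : ℝ)| |(p.2 : ℝ)| with h | h <;> rw [h, sq_abs] <;> gcongr <;>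
      nlinarith [sq_nonneg (p.1 : ℝ), sq_nonneg (p.2 : ℝ)]
  calc (nrm p : ℝ) ^ (-σ) ≤ (‖p‖ ^ 2 / 2) ^ (-σ) :=
        Real.rpow_le_rpow_of_nonpos (by positivity) norm_p_sq_le (by linarith)
    _ = 2 ^ σ * ‖p‖ ^ (-(2 * σ)) := by
        rw [Real.div_rpow (by positivity) (by norm_num), ← Real.rpow_natCast, ← Real.rpow_mul
          norm_p_pos.le, Real.rpow_neg (by norm_num : (0 : ℝ) ≤ 2), div_inv_eq_mul, mul_comm]
        push_cast
        ring_nf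

theorem summable_nrm_rpow_neg {σ : ℝ} (hσ : 1 < σ) : Summable fun p => (nrm p : ℝ) ^ (-σ) :=
  Summable.of_nonneg_of_le (fun p => Real.rpow_nonneg (Int.cast_nonneg (nrm_nonneg p)) _)
    (nrm_rpow_neg_le (by linarith))
    ((summable_one_div_norm_rpow_int_prod (by linarith)).mul_left _)

theorem chi_pow_of_odd {k : ℕ} (hk : Odd k) (p : ℤ × ℤ) : chi p ^ k = eps p * lam p ^ k := by
  rw [chi, mul_pow, ← Int.cast_pow, eps, legendreSym_pow_of_odd 7 _ hk, lam]

theorem eps_eq_zero_or_nrm_pos (p : ℤ × ℤ) : eps p = 0 ∨ (0 : ℝ) < nrm p := by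
  rcases eq_or_ne p (0, 0) with rfl | hp
  · exact Or.inl eps_zero
  · exact Or.inr (Int.cast_pos.2 (nrm_pos hp))

theorem norm_lam_pow (k : ℕ) (p : ℤ × ℤ) : ‖lam p‖ ^ k = (nrm p : ℝ) ^ ((k : ℝ) / 2) := by
  rw [← norm_lam_sq, ← Real.rpow_natCast, ← Real.rpow_natCast, ← Real.rpow_mul (norm_nonneg _)]
  congr 1
  push_cast
  ring

theorem norm_eps_mul_lam_pow_div_rpow_le (k : ℕ) (σ : ℝ) (p : ℤ × ℤ) :
    ‖(eps p * lam p ^ k : ℂ)‖ / (nrm p : ℝ) ^ (σ + k / 2) ≤ (nrm p : ℝ) ^ (-σ) := by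
  rcases eps_eq_zero_or_nrm_pos p with h | h
  · have hN : (0 : ℝ) ≤ nrm p := Int.cast_nonneg (nrm_nonneg p)
    simpa [h] using Real.rpow_nonneg hN (-σ)
  rw [norm_mul, norm_pow, norm_lam_pow, Real.rpow_add h, Real.rpow_neg h.le,
    div_le_iff₀ (by positivity), inv_mul_cancel_left₀ (by positivity)]
  exact mul_le_of_le_one_left (by positivity) (norm_eps_le_one p)

theorem hasSum_mellin_heckeTheta (k : ℕ) {s : ℂ} (hs : 1 < s.re) :
    HasSum (fun p => Gamma (s + k / 2) * (eps p * lam p ^ k) /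
      ((2 * Real.pi / 7 * nrm p : ℝ) : ℂ) ^ (s + k / 2)) (mellin (heckeTheta k) (s + k / 2)) := by
  have hre : (s + k / 2 : ℂ).re = s.re + k / 2 := by simp
  refine hasSum_mellin (fun p => ?_) (by rw [hre]; positivity) (fun x hx => hasSum_heckeTheta k hx)
    (Summable.of_nonneg_of_le (fun p => ?_) (fun p => ?_)
      ((summable_nrm_rpow_neg hs).mul_left ((2 * Real.pi / 7) ^ (s.re + k / 2))⁻¹))
  · rcases eps_eq_zero_or_nrm_pos p with h | h
    · simp [h]
    · exact Or.inr (by positivity)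
  · have hN : (0 : ℝ) ≤ nrm p := Int.cast_nonneg (nrm_nonneg p)
    positivity
  · rw [hre, Real.mul_rpow (by positivity) (Int.cast_nonneg (nrm_nonneg p)),
      div_mul_eq_div_div_swap, div_eq_inv_mul]
    gcongr
    exact norm_eps_mul_lam_pow_div_rpow_le k s.re p

/-- The entire continuation of `L(s, χ ^ k)` for odd `k`, as a Mellin transform. -/
def heckeMellin (k : ℕ) (s : ℂ) : ℂ :=
  1 / 2 * ((2 * Real.pi / 7 : ℝ) : ℂ) ^ (s + k / 2) * (Gamma (s + k / 2))⁻¹ *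
    mellin (heckeTheta k) (s + k / 2)

theorem differentiable_heckeMellin (k : ℕ) : Differentiable ℂ (heckeMellin k) := by
  have hshift : Differentiable ℂ fun s : ℂ => s + k / 2 := by fun_prop
  have hpow : Differentiable ℂ fun s : ℂ => ((2 * Real.pi / 7 : ℝ) : ℂ) ^ (s + k / 2) :=
    hshift.const_cpow (Or.inl (ofReal_ne_zero.2 (by positivity)))
  exact ((hpow.const_mul _).mul (differentiable_one_div_Gamma.comp hshift)).mul
    ((differentiable_mellin_heckeTheta k).comp hshift)

theorem hasSum_term {k : ℕ} (hk : Odd k) {s : ℂ} (hs : 1 < s.re) :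
    HasSum (term k s) (heckeMellin k s) := by
  have hΓ : Gamma (s + k / 2) ≠ 0 := Gamma_ne_zero_of_re_pos (by
    rw [add_re, ← ofReal_natCast, ← ofReal_ofNat, ← ofReal_div, ofReal_re]
    positivity)
  refine ((hasSum_mellin_heckeTheta k hs).mul_left _).congr_fun fun p => ?_
  rw [term, chi_pow_of_odd hk]
  rcases eps_eq_zero_or_nrm_pos p with h | h
  · simp [h]
  have hpow : ((2 * Real.pi / 7 : ℝ) : ℂ) ^ (s + k / 2) ≠ 0 := by
    rw [Ne, cpow_eq_zero_iff, ofReal_eq_zero]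
    exact fun h => (by positivity : 2 * Real.pi / 7 ≠ 0) h.1
  rw [ofReal_mul, mul_cpow_ofReal_nonneg (by positivity) h.le, ofReal_intCast]
  generalize ((2 * Real.pi / 7 : ℝ) : ℂ) ^ (s + k / 2) = z at hpow ⊢
  generalize Gamma (s + k / 2) = w at hΓ ⊢
  field_simp

theorem isHeckeL_heckeMellin {k : ℕ} (hk : Odd k) : IsHeckeL k (heckeMellin k) := by
  refine ⟨differentiable_heckeMellin k, fun s hs =>
    (hasSum_subtype_iff_of_support_subset (s := {p | p ≠ (0, 0)}) ?_).2 (hasSum_term hk hs)⟩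
  rintro p hp rfl
  exact hp (by simp [term, chi_pow_of_odd hk, eps_zero])

theorem isHeckeL_heckeL {k : ℕ} (hk : Odd k) : IsHeckeL k (heckeL k) :=
  Classical.epsilon_spec ⟨_, isHeckeL_heckeMellin hk⟩

theorem heckeL_eq_heckeMellin {k : ℕ} (hk : Odd k) : heckeL k = heckeMellin k :=
  (isHeckeL_heckeL hk).unique (isHeckeL_heckeMellin hk)

/-! ### The approximate functional equation -/

section MellinFolding

variable {E : Type*} [NormedAddCommGroup E] [NormedSpace ℂ E]

theorem mellin_indicator_Ioi_one (f : ℝ → E) (s : ℂ) :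
    mellin ((Set.Ioi 1).indicator f) s = ∫ t : ℝ in Set.Ioi 1, (t : ℂ) ^ (s - 1) • f t := by
  have h (t : ℝ) : (t : ℂ) ^ (s - 1) • (Set.Ioi (1 : ℝ)).indicator f t =
      (Set.Ioi 1).indicator (fun t : ℝ => (t : ℂ) ^ (s - 1) • f t) t := by
    by_cases ht : t ∈ Set.Ioi 1 <;> simp only [ht, Set.indicator_of_mem, Set.indicator_of_notMem,
      smul_zero, not_false_eq_true]
  simp_rw [mellin, h]
  rw [MeasureTheory.setIntegral_indicator measurableSet_Ioi,
    Set.inter_eq_right.2 (Set.Ioi_subset_Ioi zero_le_one)]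

theorem mellinConvergent_indicator {f : ℝ → E} {s : ℂ} (hf : MellinConvergent f s) {A : Set ℝ}
    (hA : MeasurableSet A) : MellinConvergent (A.indicator f) s := by
  refine (MeasureTheory.IntegrableOn.indicator hf hA).congr (Eventually.of_forall fun t => ?_)
  exact congrFun (A.indicator_smul (fun t : ℝ => (t : ℂ) ^ (s - 1)) f) t

theorem mellin_indicator_Iio_one {f : ℝ → E} {s : ℂ}
    (hinv : ∀ t : ℝ, 0 < t → f t⁻¹ = (t : ℂ) ^ (2 * s) • f t) :
    mellin ((Set.Iio 1).indicator f) s = mellin ((Set.Ioi 1).indicator f) s := by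
  calc mellin ((Set.Iio 1).indicator f) s
      = mellin (fun t => (t : ℂ) ^ (-(2 * s)) • (Set.Ioi 1).indicator f t⁻¹) s := by
        refine MeasureTheory.setIntegral_congr_fun measurableSet_Ioi fun t (ht : 0 < t) => ?_
        beta_reduce
        rw [Set.indicator_apply, Set.indicator_apply]
        simp only [Set.mem_Iio, Set.mem_Ioi, one_lt_inv₀ ht]
        split_ifs
        · rw [hinv t ht, cpow_neg,
            inv_smul_smul₀ (by simp [cpow_eq_zero_iff, ht.ne'])]
        · rw [smul_zero, smul_zero, smul_zero]
    _ = mellin ((Set.Ioi 1).indicator f) s := by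
        rw [mellin_cpow_smul (fun t => (Set.Ioi 1).indicator f t⁻¹), mellin_comp_inv]
        congr 1
        ring

theorem mellin_eq_two_smul_integral_Ioi_one {f : ℝ → E} {s : ℂ} (hf : MellinConvergent f s)
    (hinv : ∀ t : ℝ, 0 < t → f t⁻¹ = (t : ℂ) ^ (2 * s) • f t) :
    mellin f s = (2 : ℂ) • ∫ t : ℝ in Set.Ioi 1, (t : ℂ) ^ (s - 1) • f t := by
  have hsplit : mellin f s =
      mellin (fun t => (Set.Iio 1).indicator f t + (Set.Ioi 1).indicator f t) s := by
    refine MeasureTheory.setIntegral_congr_ae measurableSet_Ioi ?_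
    filter_upwards [MeasureTheory.Measure.ae_ne MeasureTheory.volume 1] with t ht _
    rcases lt_or_gt_of_ne ht with h | h <;> simp [h, h.not_gt]
  rw [hsplit, (hasMellin_add (mellinConvergent_indicator hf measurableSet_Iio)
      (mellinConvergent_indicator hf measurableSet_Ioi)).2,
    mellin_indicator_Iio_one hinv, mellin_indicator_Ioi_one, two_smul]

end MellinFolding

/-- The regularised upper incomplete Gamma function `Γ(M, y) / Γ(M)` at an integer `M`, through its
finite expansion. -/
def gammaQ (M : ℕ) (y : ℝ) : ℝ := Real.exp (-y) * ∑ j ∈ range M, y ^ j / j.factorial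

theorem gammaQ_succ (M : ℕ) (y : ℝ) :
    gammaQ (M + 1) y = gammaQ M y + Real.exp (-y) * (y ^ M / M.factorial) := by
  rw [gammaQ, sum_range_succ, mul_add, gammaQ]

theorem gammaQ_succ_zero (M : ℕ) : gammaQ (M + 1) 0 = 1 := by
  simp [gammaQ, sum_range_succ']

theorem gammaQ_nonneg (M : ℕ) {y : ℝ} (hy : 0 ≤ y) : 0 ≤ gammaQ M y := by
  unfold gammaQ
  positivity

theorem gammaQ_le_one (M : ℕ) {y : ℝ} (hy : 0 ≤ y) : gammaQ M y ≤ 1 := by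
  calc gammaQ M y ≤ Real.exp (-y) * Real.exp y := by
        unfold gammaQ
        gcongr
        exact Real.sum_le_exp_of_nonneg hy M
    _ = 1 := by rw [← Real.exp_add, neg_add_cancel, Real.exp_zero]

theorem gammaQ_mono {y : ℝ} (hy : 0 ≤ y) : Monotone fun M => gammaQ M y := by
  refine monotone_nat_of_le_succ fun M => ?_
  rw [gammaQ_succ]
  exact le_add_of_nonneg_right (by positivity)

theorem gammaQ_le_exp (M : ℕ) {y : ℝ} (hy : 0 ≤ y) :
    gammaQ M y ≤ 2 ^ M * Real.exp (-(y / 2)) := by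
  have hterm (j : ℕ) (hj : j ∈ range M) :
      y ^ j / j.factorial ≤ 2 ^ M * ((y / 2) ^ j / j.factorial) := by
    rw [show y ^ j = 2 ^ j * (y / 2) ^ j by rw [← mul_pow]; congr 1; ring, mul_div_assoc]
    gcongr
    · norm_num
    · exact (mem_range.1 hj).le
  calc gammaQ M y ≤ Real.exp (-y) * (2 ^ M * Real.exp (y / 2)) := by
        unfold gammaQ
        gcongr
        refine (sum_le_sum hterm).trans ?_
        rw [← mul_sum]
        gcongr
        exact Real.sum_le_exp_of_nonneg (by positivity) M
    _ = 2 ^ M * Real.exp (-(y / 2)) := by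
        rw [mul_left_comm, ← Real.exp_add]
        ring_nf

theorem hasDerivAt_gammaQ_succ (m : ℕ) (y : ℝ) :
    HasDerivAt (gammaQ (m + 1)) (-(Real.exp (-y) * (y ^ m / m.factorial))) y := by
  have hexp : HasDerivAt (fun y : ℝ => Real.exp (-y)) (-Real.exp (-y)) y := by
    simpa using (hasDerivAt_neg y).exp
  induction m with
  | zero =>
    have hfun : gammaQ 1 = fun y => Real.exp (-y) := by
      funext y
      simp [gammaQ]
    simpa [hfun] using hexp
  | succ m ih =>
    rw [funext (gammaQ_succ (m + 1))]
    convert! ih.add (hexp.mul ((hasDerivAt_pow (m + 1) y).div_const _)) using 1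
    rw [Nat.factorial_succ]
    push_cast
    field_simp
    ring

theorem antitoneOn_gammaQ_succ (m : ℕ) : AntitoneOn (gammaQ (m + 1)) (Set.Ici 0) := by
  refine antitoneOn_of_hasDerivWithinAt_nonpos (convex_Ici 0)
    (fun y _ => (hasDerivAt_gammaQ_succ m y).continuousAt.continuousWithinAt)
    (fun y _ => (hasDerivAt_gammaQ_succ m y).hasDerivWithinAt) fun y hy => ?_
  have hy : 0 < y := by simpa using hy
  exact neg_nonpos.2 (by positivity)

theorem tendsto_gammaQ_atTop (M : ℕ) : Tendsto (gammaQ M) atTop (nhds 0) := by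
  have h : Tendsto (fun y : ℝ => 2 ^ M * Real.exp (-(y / 2))) atTop (nhds (2 ^ M * 0)) :=
    (Real.tendsto_exp_neg_atTop_nhds_zero.comp
      (tendsto_id.atTop_div_const (by norm_num : (0 : ℝ) < 2))).const_mul _
  rw [mul_zero] at h
  refine tendsto_of_tendsto_of_tendsto_of_le_of_le' tendsto_const_nhds h ?_ ?_ <;>
    filter_upwards [eventually_ge_atTop 0] with y hy
  exacts [gammaQ_nonneg M hy, gammaQ_le_exp M hy]

section IntegralIoiOne

open MeasureTheory

theorem hasDerivAt_gammaQ_mul (m : ℕ) {ν : ℝ} (hν : 0 < ν) (t : ℝ) :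
    HasDerivAt (fun t => -(m.factorial / ν ^ (m + 1) * gammaQ (m + 1) (ν * t)))
      (t ^ m * Real.exp (-ν * t)) t := by
  have h := ((hasDerivAt_gammaQ_succ m (ν * t)).comp t
    ((hasDerivAt_id t).const_mul ν)).const_mul (m.factorial / ν ^ (m + 1))
  convert! h.neg using 1
  rw [mul_one, mul_pow]
  field_simp
  ring

theorem tendsto_gammaQ_mul_atTop (m : ℕ) {ν : ℝ} (hν : 0 < ν) :
    Tendsto (fun t => -(m.factorial / ν ^ (m + 1) * gammaQ (m + 1) (ν * t))) atTop (nhds 0) := by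
  simpa using (((tendsto_gammaQ_atTop (m + 1)).comp (tendsto_id.const_mul_atTop hν)).const_mul
    (m.factorial / ν ^ (m + 1))).neg

theorem pow_mul_exp_nonneg_of_mem_Ioi_one (m : ℕ) (ν : ℝ) :
    ∀ t ∈ Set.Ioi (1 : ℝ), 0 ≤ t ^ m * Real.exp (-ν * t) := fun t ht => by
  have : 0 < t := one_pos.trans ht
  positivity

theorem integrableOn_pow_mul_exp_Ioi_one (m : ℕ) {ν : ℝ} (hν : 0 < ν) :
    IntegrableOn (fun t : ℝ => t ^ m * Real.exp (-ν * t)) (Set.Ioi 1) :=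
  integrableOn_Ioi_deriv_of_nonneg' (fun t _ => hasDerivAt_gammaQ_mul m hν t)
    (pow_mul_exp_nonneg_of_mem_Ioi_one m ν) (tendsto_gammaQ_mul_atTop m hν)

theorem integral_pow_mul_exp_Ioi_one (m : ℕ) {ν : ℝ} (hν : 0 < ν) :
    ∫ t in Set.Ioi (1 : ℝ), t ^ m * Real.exp (-ν * t) =
      m.factorial / ν ^ (m + 1) * gammaQ (m + 1) ν := by
  rw [integral_Ioi_of_hasDerivAt_of_nonneg' (fun t _ => hasDerivAt_gammaQ_mul m hν t)
    (pow_mul_exp_nonneg_of_mem_Ioi_one m ν) (tendsto_gammaQ_mul_atTop m hν)]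
  simp

theorem hasSum_integral_pow_mul_Ioi_one {ι : Type*} [Countable ι] {a : ι → ℂ} {ν : ι → ℝ}
    {F : ℝ → ℂ} {m : ℕ} (hν : ∀ i, a i = 0 ∨ 0 < ν i)
    (hF : ∀ t : ℝ, 1 < t → HasSum (fun i => a i * Real.exp (-ν i * t)) (F t))
    (hsum : Summable fun i => ‖a i‖ * (m.factorial / ν i ^ (m + 1) * gammaQ (m + 1) (ν i))) :
    HasSum (fun i => a i * ((m.factorial / ν i ^ (m + 1) * gammaQ (m + 1) (ν i) : ℝ) : ℂ))
      (∫ t : ℝ in Set.Ioi 1, (t : ℂ) ^ m * F t) := by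
  let f (i : ι) (t : ℝ) : ℂ := a i * ((t ^ m * Real.exp (-ν i * t) : ℝ) : ℂ)
  have hint (i : ι) : Integrable (f i) (volume.restrict (Set.Ioi 1)) := by
    rcases hν i with h | h
    · simp [f, h]
    · exact (integrableOn_pow_mul_exp_Ioi_one m h).ofReal.const_mul _
  have integral_f (i : ι) : ∫ t in Set.Ioi (1 : ℝ), f i t =
      a i * ((m.factorial / ν i ^ (m + 1) * gammaQ (m + 1) (ν i) : ℝ) : ℂ) := by
    rcases hν i with h | h
    · simp [f, h]
    · rw [integral_const_mul, integral_complex_ofReal, integral_pow_mul_exp_Ioi_one m h]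
  have integral_norm_f (i : ι) : ∫ t in Set.Ioi (1 : ℝ), ‖f i t‖ =
      ‖a i‖ * (m.factorial / ν i ^ (m + 1) * gammaQ (m + 1) (ν i)) := by
    rcases hν i with h | h
    · simp [f, h]
    rw [← integral_pow_mul_exp_Ioi_one m h, ← integral_const_mul]
    refine setIntegral_congr_fun measurableSet_Ioi fun t ht => ?_
    rw [norm_mul, norm_real, Real.norm_of_nonneg (pow_mul_exp_nonneg_of_mem_Ioi_one m _ t ht)]
  have hswap := hasSum_integral_of_summable_integral_norm hint (by simpa only [integral_norm_f])
  simp_rw [integral_f] at hswap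
  convert! hswap using 1
  refine setIntegral_congr_fun measurableSet_Ioi fun t ht => ?_
  rw [← ((hF t ht).mul_left _).tsum_eq]
  refine tsum_congr fun i => ?_
  simp only [f, ofReal_mul, ofReal_pow]
  ring

end IntegralIoiOne

theorem mellin_heckeTheta_center (j : ℕ) :
    mellin (heckeTheta (4 * j + 1)) (2 * j + 1) =
      2 * ∫ t : ℝ in Set.Ioi 1, (t : ℂ) ^ (2 * j) * heckeTheta (4 * j + 1) t := by
  have hsign : I * (-I) ^ (4 * j + 1) = 1 := by
    rw [pow_succ, pow_mul, Even.neg_pow (by decide), I_pow_four, one_pow, one_mul, mul_neg,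
      I_mul_I, neg_neg]
  have hinv (t : ℝ) (ht : 0 < t) :
      heckeTheta (4 * j + 1) t⁻¹ = (t : ℂ) ^ (2 * (2 * j + 1 : ℂ)) • heckeTheta (4 * j + 1) t := by
    rw [← one_div, heckeTheta_one_div _ ht, hsign, one_mul, smul_eq_mul, ← cpow_natCast]
    push_cast
    ring_nf
  rw [mellin_eq_two_smul_integral_Ioi_one (mellinConvergent_heckeTheta _ _) hinv, smul_eq_mul]
  simp_rw [add_sub_cancel_right, smul_eq_mul, ← cpow_natCast]
  push_cast
  rfl

/-- The term of index `p` in the rapidly convergent series for `L(1/2, χ ^ (4j + 1))` which the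
functional equation provides. -/
def centralTerm (j : ℕ) (p : ℤ × ℤ) : ℂ :=
  eps p * lam p ^ (4 * j + 1) / (nrm p : ℂ) ^ (2 * j + 1) *
    gammaQ (2 * j + 1) (2 * Real.pi / 7 * nrm p)

theorem norm_mul_gammaQ_div_pow_le (k m : ℕ) (p : ℤ × ℤ) :
    ‖(eps p * lam p ^ k : ℂ)‖ * (m.factorial / (2 * Real.pi / 7 * nrm p) ^ (m + 1) *
        gammaQ (m + 1) (2 * Real.pi / 7 * nrm p)) ≤
      m.factorial / (2 * Real.pi / 7) ^ (m + 1) * 2 ^ (m + 1) *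
        ‖(eps p * lam p ^ k * Real.exp (-(Real.pi * (1 / 7) * nrm p)) : ℂ)‖ := by
  rcases eq_or_ne p (0, 0) with rfl | hp
  · simp [eps_zero]
  have hN := one_le_nrm hp
  have hy : 2 * Real.pi / 7 ≤ 2 * Real.pi / 7 * nrm p := le_mul_of_one_le_right (by positivity) hN
  have hQ := gammaQ_le_exp (m + 1) (hy.trans' (by positivity))
  rw [show -(2 * Real.pi / 7 * nrm p / 2) = -(Real.pi * (1 / 7) * nrm p) by ring] at hQ
  rw [norm_mul _ (ofReal _), norm_real, Real.norm_of_nonneg (Real.exp_pos _).le]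
  calc _ ≤ ‖(eps p * lam p ^ k : ℂ)‖ * (m.factorial / (2 * Real.pi / 7) ^ (m + 1) *
        (2 ^ (m + 1) * Real.exp (-(Real.pi * (1 / 7) * nrm p)))) := by
        gcongr
        exact gammaQ_nonneg _ (hy.trans' (by positivity))
    _ = _ := by ring

theorem hasSum_integral_heckeTheta (k m : ℕ) :
    HasSum (fun p => eps p * lam p ^ k *
      ((m.factorial / (2 * Real.pi / 7 * nrm p) ^ (m + 1) *
        gammaQ (m + 1) (2 * Real.pi / 7 * nrm p) : ℝ) : ℂ))
      (∫ t : ℝ in Set.Ioi 1, (t : ℂ) ^ m * heckeTheta k t) := by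
  refine hasSum_integral_pow_mul_Ioi_one (fun p => ?_)
    (fun t ht => hasSum_heckeTheta k (one_pos.trans ht))
    (Summable.of_nonneg_of_le (fun p => ?_) (norm_mul_gammaQ_div_pow_le k m)
      ((summable_eps_mul_lam_pow_mul_exp k (by norm_num)).norm.mul_left _))
  · rcases eps_eq_zero_or_nrm_pos p with h | h
    · simp [h]
    · exact Or.inr (by positivity)
  · have hy : 0 ≤ 2 * Real.pi / 7 * nrm p :=
      mul_nonneg (by positivity) (Int.cast_nonneg (nrm_nonneg p))
    have := gammaQ_nonneg (m + 1) hy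
    positivity

theorem heckeL_center_eq (j : ℕ) :
    heckeL (4 * j + 1) (1 / 2) = ((2 * Real.pi / 7 : ℝ) : ℂ) ^ (2 * j + 1) / (2 * j).factorial *
      ∫ t : ℝ in Set.Ioi 1, (t : ℂ) ^ (2 * j) * heckeTheta (4 * j + 1) t := by
  have hs : (1 / 2 : ℂ) + (4 * j + 1 : ℕ) / 2 = 2 * j + 1 := by
    push_cast
    ring
  have hΓ : Gamma (2 * j + 1) = (2 * j).factorial := by
    rw [← Gamma_nat_eq_factorial]
    push_cast
    rfl
  rw [heckeL_eq_heckeMellin ⟨2 * j, by ring⟩, heckeMellin, hs, mellin_heckeTheta_center, hΓ,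
    ← cpow_natCast]
  push_cast
  ring

theorem hasSum_centralTerm (j : ℕ) :
    HasSum (centralTerm j) (heckeL (4 * j + 1) (1 / 2)) := by
  rw [heckeL_center_eq]
  refine ((hasSum_integral_heckeTheta (4 * j + 1) (2 * j)).mul_left _).congr_fun fun p => ?_
  rw [centralTerm]
  rcases eps_eq_zero_or_nrm_pos p with h | _
  · simp [h]
  have hc : ((2 * Real.pi / 7 : ℝ) : ℂ) ≠ 0 := ofReal_ne_zero.2 (by positivity)
  have hfact : ((2 * j).factorial : ℂ) ≠ 0 := Nat.cast_ne_zero.2 (Nat.factorial_ne_zero _)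
  generalize gammaQ (2 * j + 1) (2 * Real.pi / 7 * nrm p) = G
  generalize 2 * Real.pi / 7 = c at hc
  push_cast
  rw [mul_pow]
  field_simp

/-! ### Summation by parts and the value at `1` -/

section AbelSummation

variable {E : Type*} [NormedAddCommGroup E] [NormedSpace ℝ E]

theorem norm_sum_smul_le {a : ℕ → E} {B : ℝ} (hB : ∀ n, ‖∑ i ∈ range n, a i‖ ≤ B) (v : ℕ → ℝ)
    (n : ℕ) :
    ‖∑ i ∈ range n, v i • a i‖ ≤ B * (|v n| + ∑ i ∈ range n, |v (i + 1) - v i|) := by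
  have by_parts : ∑ i ∈ range n, v i • a i = v n • ∑ i ∈ range n, a i -
      ∑ i ∈ range n, (v (i + 1) - v i) • ∑ l ∈ range (i + 1), a l := by
    have h := sum_range_by_parts v a (n + 1)
    rw [Nat.add_sub_cancel, sum_range_succ, sum_range_succ a, smul_add] at h
    rw [← add_left_inj (v n • a n), h]
    abel
  have norm_smul_le (x : ℝ) (m : ℕ) : ‖x • ∑ i ∈ range m, a i‖ ≤ B * |x| := by
    rw [norm_smul, Real.norm_eq_abs, mul_comm]
    gcongr
    exact hB m
  rw [by_parts, mul_add, mul_sum]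
  exact (norm_sub_le _ _).trans
    (add_le_add (norm_smul_le _ _) (norm_sum_le_of_le _ fun i _ => norm_smul_le _ _))

theorem norm_sum_smul_le_of_monotone {a : ℕ → E} {B : ℝ} (hB : ∀ n, ‖∑ i ∈ range n, a i‖ ≤ B)
    {v : ℕ → ℝ} (hv : Monotone v) (hv0 : ∀ i, 0 ≤ v i) (n : ℕ) :
    ‖∑ i ∈ range n, v i • a i‖ ≤ 2 * B * v n := by
  have hB0 : 0 ≤ B := (norm_nonneg _).trans (hB 0)
  have htel : ∑ i ∈ range n, |v (i + 1) - v i| = v n - v 0 := by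
    rw [← sum_range_sub]
    exact sum_congr rfl fun i _ => abs_of_nonneg (sub_nonneg.2 (hv i.le_succ))
  refine (norm_sum_smul_le hB v n).trans ?_
  rw [htel, abs_of_nonneg (hv0 n)]
  nlinarith [mul_nonneg hB0 (hv0 0)]

end AbelSummation

theorem norm_sum_range_le_of_periodic {E : Type*} [SeminormedAddCommGroup E] {a : ℕ → E} {N : ℕ}
    (hN : 0 < N) (ha : Function.Periodic a N) (hsum : ∑ i ∈ range N, a i = 0)
    {C : ℝ} (hC : ∀ i, ‖a i‖ ≤ C) (n : ℕ) : ‖∑ i ∈ range n, a i‖ ≤ N * C := by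
  have hperiods (q : ℕ) : ∑ i ∈ range (q * N), a i = 0 := by
    induction q with
    | zero => simp
    | succ q ih =>
      rw [Nat.succ_mul, sum_range_add, ih, zero_add, ← hsum]
      exact sum_congr rfl fun i _ => by rw [add_comm]; exact ha.nat_mul q i
  rw [← Nat.div_add_mod' n N, sum_range_add, hperiods, zero_add]
  have hC0 : 0 ≤ C := (norm_nonneg _).trans (hC 0)
  calc _ ≤ ∑ _i ∈ range (n % N), C := norm_sum_le_of_le _ fun i _ => hC _
    _ = (n % N : ℕ) * C := by rw [sum_const, card_range, nsmul_eq_mul]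
    _ ≤ N * C := mul_le_mul_of_nonneg_right (Nat.cast_le.2 (Nat.mod_lt n hN).le) hC0

theorem one_div_sub_one_div_nonneg (i : ℕ) : 0 ≤ 1 / ((i : ℝ) + 1) - 1 / (i + 2) := by
  rw [sub_nonneg]
  gcongr
  norm_num

theorem abs_div_succ_sub_div_succ_le {h : ℕ → ℝ} (hmono : Monotone h) (h0 : ∀ i, 0 ≤ h i) (i : ℕ) :
    |h (i + 1) / ((i + 1 : ℕ) + 1) - h i / (i + 1)| ≤
      2 * (h i * (1 / ((i : ℝ) + 1) - 1 / (i + 2))) +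
        (h (i + 1) / ((i + 1 : ℕ) + 1) - h i / (i + 1)) := by
  have hsplit : h (i + 1) / ((i + 1 : ℕ) + 1) - h i / (i + 1) =
      (h (i + 1) - h i) / ((i : ℝ) + 2) - h i * (1 / ((i : ℝ) + 1) - 1 / (i + 2)) := by
    push_cast
    field_simp
    ring
  have hincr : 0 ≤ (h (i + 1) - h i) / ((i : ℝ) + 2) :=
    div_nonneg (sub_nonneg.2 (hmono i.le_succ)) (by positivity)
  have hdecr := mul_nonneg (h0 i) (one_div_sub_one_div_nonneg i)
  rw [hsplit, abs_le]
  constructor <;> linarith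

theorem norm_sum_div_succ_smul_le {E : Type*} [NormedAddCommGroup E] [NormedSpace ℝ E]
    {a : ℕ → E} {B : ℝ} (hB : ∀ n, ‖∑ i ∈ range n, a i‖ ≤ B)
    {h : ℕ → ℝ} (hmono : Monotone h) (h0 : ∀ i, 0 ≤ h i) (h1 : ∀ i, h i ≤ 1) (n : ℕ) :
    ‖∑ i ∈ range n, (h i / (i + 1)) • a i‖ ≤
      2 * B * (1 / (n + 1) + ∑ i ∈ range n, h i * (1 / ((i : ℝ) + 1) - 1 / (i + 2))) := by
  have hB0 : 0 ≤ B := (norm_nonneg _).trans (hB 0)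
  have hn0 : 0 ≤ h n / ((n : ℝ) + 1) := div_nonneg (h0 n) (by positivity)
  have hn1 : h n / ((n : ℝ) + 1) ≤ 1 / (n + 1) := by gcongr; exact h1 n
  have h00 : 0 ≤ h 0 / ((0 : ℕ) + 1) := div_nonneg (h0 0) (by positivity)
  have hvar : ∑ i ∈ range n, |h (i + 1) / ((i + 1 : ℕ) + 1) - h i / (i + 1)| ≤
      2 * (∑ i ∈ range n, h i * (1 / ((i : ℝ) + 1) - 1 / (i + 2))) + h n / (n + 1) := by
    refine (sum_le_sum fun i _ => abs_div_succ_sub_div_succ_le hmono h0 i).trans ?_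
    rw [sum_add_distrib, ← mul_sum, sum_range_sub fun i : ℕ => h i / (i + 1)]
    linarith
  refine (norm_sum_smul_le hB (fun i => h i / (i + 1)) n).trans ?_
  rw [abs_of_nonneg hn0, mul_comm 2 B, mul_assoc]
  gcongr
  linarith

theorem sum_one_div_sub_one_div_le (K n : ℕ) :
    ∑ i ∈ range n, (1 / (((K + i : ℕ) : ℝ) + 1) - 1 / ((K + i : ℕ) + 2)) ≤ 1 / ((K : ℝ) + 1) := by
  have h := sum_range_sub' (fun i : ℕ => 1 / (((K + i : ℕ) : ℝ) + 1)) n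
  calc _ = 1 / (((K + 0 : ℕ) : ℝ) + 1) - 1 / ((K + n : ℕ) + 1) := by
        rw [← h]
        refine sum_congr rfl fun i _ => ?_
        push_cast
        ring
    _ ≤ _ := by
        rw [add_zero]
        exact sub_le_self _ (by positivity)

theorem sum_mul_one_div_sub_one_div_le {h : ℕ → ℝ} (h0 : ∀ i, 0 ≤ h i) (h1 : ∀ i, h i ≤ 1) {δ : ℝ}
    (hδ : 0 < δ) (hle : ∀ i : ℕ, h i ≤ δ * ((i : ℝ) + 1) ^ 2) (n : ℕ) :
    ∑ i ∈ range n, h i * (1 / ((i : ℝ) + 1) - 1 / (i + 2)) ≤ 2 * √δ := by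
  set K := ⌊1 / √δ⌋₊
  have hnonneg (i : ℕ) : 0 ≤ h i * (1 / ((i : ℝ) + 1) - 1 / (i + 2)) :=
    mul_nonneg (h0 i) (one_div_sub_one_div_nonneg i)
  have hhead (i : ℕ) : h i * (1 / ((i : ℝ) + 1) - 1 / (i + 2)) ≤ δ := by
    calc _ ≤ δ * ((i : ℝ) + 1) ^ 2 * (1 / ((i : ℝ) + 1) - 1 / (i + 2)) :=
          mul_le_mul_of_nonneg_right (hle i) (one_div_sub_one_div_nonneg i)
      _ = δ * (((i : ℝ) + 1) / (i + 2)) := by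
          field_simp
          ring
      _ ≤ δ := mul_le_of_le_one_right hδ.le (div_le_one_of_le₀ (by linarith) (by positivity))
  calc _ ≤ ∑ i ∈ range (K + n), h i * (1 / ((i : ℝ) + 1) - 1 / (i + 2)) :=
        sum_le_sum_of_subset_of_nonneg (range_subset_range.2 (Nat.le_add_left _ _))
          fun i _ _ => hnonneg i
    _ ≤ K * δ + 1 / (K + 1) := by
        rw [sum_range_add]
        refine add_le_add ?_ ((sum_le_sum fun i _ => ?_).trans (sum_one_div_sub_one_div_le K n))
        · simpa using sum_le_sum fun i (_ : i ∈ range K) => hhead i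
        · exact mul_le_of_le_one_left (one_div_sub_one_div_nonneg _) (h1 _)
    _ ≤ 1 / √δ * δ + 1 / (1 / √δ) := by
        gcongr
        · exact Nat.floor_le (by positivity)
        · exact (Nat.lt_floor_add_one _).le
    _ = 2 * √δ := by rw [one_div_one_div, one_div_mul_eq_div, Real.div_sqrt, two_mul]

theorem norm_sub_le_of_hasSum_smoothed {E : Type*} [NormedAddCommGroup E] [NormedSpace ℝ E]
    {a : ℕ → E} {B : ℝ} (hB : ∀ n, ‖∑ i ∈ range n, a i‖ ≤ B)
    {L : E} (hL : Tendsto (fun n => ∑ i ∈ range n, (1 / ((i : ℝ) + 1)) • a i) atTop (nhds L))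
    {g : ℕ → ℝ} (hanti : Antitone g) (g0 : ∀ i, 0 ≤ g i) (g1 : ∀ i, g i ≤ 1) {δ : ℝ} (hδ : 0 < δ)
    (hle : ∀ i : ℕ, 1 - g i ≤ δ * ((i : ℝ) + 1) ^ 2) {D : E}
    (hD : HasSum (fun i : ℕ => (g i / (i + 1)) • a i) D) : ‖L - D‖ ≤ 4 * B * √δ := by
  have hB0 : 0 ≤ B := (norm_nonneg _).trans (hB 0)
  have hmono : Monotone fun i => 1 - g i := fun i j hij => sub_le_sub_left (hanti hij) 1
  have h0 (i : ℕ) : 0 ≤ 1 - g i := sub_nonneg.2 (g1 i)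
  have h1 (i : ℕ) : 1 - g i ≤ 1 := sub_le_self _ (g0 i)
  have hbound : Tendsto (fun n : ℕ => 2 * B * (1 / ((n : ℝ) + 1) + 2 * √δ)) atTop
      (nhds (2 * B * (0 + 2 * √δ))) :=
    (tendsto_one_div_add_atTop_nhds_zero_nat.add_const _).const_mul _
  rw [show 4 * B * √δ = 2 * B * (0 + 2 * √δ) by ring]
  refine le_of_tendsto_of_tendsto' (hL.sub hD.tendsto_sum_nat).norm hbound fun n => ?_
  rw [← sum_sub_distrib]
  simp_rw [← sub_smul, ← sub_div]
  refine (norm_sum_div_succ_smul_le hB hmono h0 h1 n).trans ?_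
  gcongr
  exact sum_mul_one_div_sub_one_div_le h0 h1 hδ hle n

theorem norm_geom_sum_le {w : ℂ} (hw : ‖w‖ = 1) (hw1 : w ≠ 1) (n : ℕ) :
    ‖∑ i ∈ range n, w ^ i‖ ≤ 2 / ‖w - 1‖ := by
  rw [geom_sum_eq hw1, norm_div]
  gcongr
  calc ‖w ^ n - 1‖ ≤ ‖w ^ n‖ + ‖(1 : ℂ)‖ := norm_sub_le _ _
    _ = 2 := by rw [norm_pow, hw, one_pow, norm_one, one_add_one_eq_two]

theorem one_sub_mem_slitPlane {z : ℂ} (hz : ‖z‖ = 1) (hz1 : z ≠ 1) : 1 - z ∈ slitPlane := by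
  refine Or.inl (sub_pos.2 (lt_of_le_of_ne ((re_le_norm z).trans_eq hz) fun h => hz1 ?_))
  have him : z.im = 0 := by
    have := sq_norm_sub_sq_re z
    rw [hz, h, one_re, sub_self] at this
    exact sq_eq_zero_iff.1 this.symm
  exact Complex.ext h him

theorem tendsto_sum_pow_div {z : ℂ} (hz : ‖z‖ = 1) (hz1 : z ≠ 1) :
    Tendsto (fun n => ∑ i ∈ range n, z ^ i / i) atTop (nhds (-log (1 - z))) := by
  have hcauchy : CauchySeq fun n => ∑ i ∈ range n, z ^ i / i := by
    have hbound (n : ℕ) : ‖∑ i ∈ range n, z ^ (i + 1)‖ ≤ 2 / ‖z - 1‖ := by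
      simp_rw [pow_succ]
      rw [← sum_mul, norm_mul, hz, mul_one]
      exact norm_geom_sum_le hz hz1 n
    have hanti : Antitone fun i : ℕ => 1 / ((i : ℝ) + 1) := fun i j hij =>
      Nat.one_div_le_one_div hij
    have h := hanti.cauchySeq_series_mul_of_tendsto_zero_of_bounded
      tendsto_one_div_add_atTop_nhds_zero_nat hbound
    rw [← cauchySeq_shift 1]
    convert h using 2 with n
    rw [sum_range_succ', Nat.cast_zero, div_zero, add_zero]
    refine sum_congr rfl fun i _ => ?_
    rw [real_smul]
    push_cast
    ring
  obtain ⟨L, hL⟩ := cauchySeq_tendsto_of_complete hcauchy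
  have habel := tendsto_map'_iff.1 (tendsto_tsum_powerSeries_nhdsWithin_lt hL)
  have hlog : Tendsto (fun r : ℝ => -log (1 - r * z)) (nhdsWithin 1 (Set.Iio 1))
      (nhds (-log (1 - z))) := by
    have : ContinuousAt (fun r : ℝ => -log (1 - r * z)) 1 := by
      refine (ContinuousAt.clog (by fun_prop) ?_).neg
      simpa using one_sub_mem_slitPlane hz hz1
    simpa using this.tendsto.mono_left nhdsWithin_le_nhds
  rwa [tendsto_nhds_unique (habel.congr' ?_) hlog] at hL
  filter_upwards [Ioo_mem_nhdsLT (zero_lt_one' ℝ)] with r ⟨hr0, hr1⟩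
  have hr : ‖(r * z : ℂ)‖ < 1 := by
    rwa [norm_mul, hz, mul_one, norm_real, Real.norm_of_nonneg hr0.le]
  rw [← (hasSum_taylorSeries_neg_log hr).tsum_eq]
  refine tsum_congr fun n => ?_
  rw [mul_pow]
  ring

theorem norm_stdAddChar {N : ℕ} [NeZero N] (j : ZMod N) : ‖(ZMod.stdAddChar j : ℂ)‖ = 1 :=
  Circle.norm_coe _

theorem tendsto_sum_dft_div {N : ℕ} [NeZero N] {Φ : ZMod N → ℂ} (hΦ : Φ 0 = 0) :
    Tendsto (fun n => ∑ i ∈ range n, ZMod.dft Φ i / i) atTop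
      (nhds (-∑ j, Φ j * log (1 - ZMod.stdAddChar (-j)))) := by
  have hpartial (n : ℕ) : ∑ i ∈ range n, ZMod.dft Φ i / i =
      ∑ j, Φ j * ∑ i ∈ range n, (ZMod.stdAddChar (-j) : ℂ) ^ i / i := by
    simp_rw [ZMod.dft_apply, mul_sum, sum_div]
    rw [sum_comm]
    refine sum_congr rfl fun j _ => sum_congr rfl fun i _ => ?_
    rw [← AddChar.map_nsmul_eq_pow, nsmul_eq_mul, smul_eq_mul, mul_neg, mul_comm (i : ZMod N)]
    ring
  simp_rw [hpartial, ← sum_neg_distrib, ← mul_neg]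
  refine tendsto_finsetSum _ fun j _ => ?_
  rcases eq_or_ne j 0 with rfl | hj
  · simp [hΦ]
  refine (tendsto_sum_pow_div (norm_stdAddChar _) fun h => hj ?_).const_mul _
  rw [← AddChar.map_zero_eq_one (ZMod.stdAddChar (N := N)), ZMod.injective_stdAddChar.eq_iff] at h
  exact neg_eq_zero.1 h

theorem arg_one_sub_exp {α : ℝ} (h0 : 0 < α) (h1 : α < Real.pi) :
    (1 - cexp (2 * α * I)).arg = α - Real.pi / 2 := by
  have hpolar : 1 - cexp (2 * α * I) = ((2 * Real.sin α : ℝ) : ℂ) *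
      (cos ((α - Real.pi / 2 : ℝ) : ℂ) + sin ((α - Real.pi / 2 : ℝ) : ℂ) * I) := by
    rw [← ofReal_cos, ← ofReal_sin, Real.cos_sub_pi_div_two, Real.sin_sub_pi_div_two, exp_mul_I,
      cos_two_mul, sin_two_mul]
    push_cast
    linear_combination -2 * sin_sq_add_cos_sq (α : ℂ)
  rw [hpolar, arg_mul_cos_add_sin_mul_I
    (mul_pos two_pos (Real.sin_pos_of_pos_of_lt_pi h0 h1)) ⟨by linarith, by linarith⟩]

theorem arg_one_sub_stdAddChar {N : ℕ} [NeZero N] {j : ZMod N} (hj : j ≠ 0) :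
    (1 - ZMod.stdAddChar j : ℂ).arg = Real.pi * j.val / N - Real.pi / 2 := by
  have hval : (0 : ℝ) < j.val := Nat.cast_pos.2 (ZMod.val_pos.2 hj)
  have hlt : (j.val : ℝ) < N := Nat.cast_lt.2 j.val_lt
  have hN : (0 : ℝ) < N := hval.trans hlt
  rw [← arg_one_sub_exp (α := Real.pi * j.val / N) (by positivity) (by
    rw [div_lt_iff₀ hN]
    exact mul_lt_mul_of_pos_left hlt Real.pi_pos), ZMod.stdAddChar_apply, ZMod.toCircle_apply]
  push_cast
  ring_nf

theorem sum_legendreChar_seven_mul_log_im :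
    (∑ j, legendreChar 7 j * log (1 - ZMod.stdAddChar (-j))).im = Real.pi := by
  have im_term (j : ZMod 7) : (legendreChar 7 j * log (1 - ZMod.stdAddChar (-j))).im =
      quadraticChar (ZMod 7) j * (Real.pi * (-j).val / 7 - Real.pi / 2) := by
    rcases eq_or_ne j 0 with rfl | hj
    · simp
    · rw [show legendreChar 7 j = ((quadraticChar (ZMod 7) j : ℝ) : ℂ) by simp [legendreChar],
        im_ofReal_mul, log_im, arg_one_sub_stdAddChar (neg_ne_zero.2 hj)]
      norm_num
  have sum_char : ∑ j, quadraticChar (ZMod 7) j = 0 := by decide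
  have sum_char_mul_val : ∑ j : ZMod 7, quadraticChar (ZMod 7) j * ((-j).val : ℤ) = 7 := by decide
  calc _ = ∑ j : ZMod 7, (Real.pi / 7 * (quadraticChar (ZMod 7) j * ((-j).val : ℤ) : ℤ) -
        Real.pi / 2 * quadraticChar (ZMod 7) j) := by
        rw [im_sum]
        refine sum_congr rfl fun j _ => ?_
        rw [im_term]
        push_cast
        ring
    _ = Real.pi := by
        rw [sum_sub_distrib, ← mul_sum, ← mul_sum, ← Int.cast_sum, ← Int.cast_sum, sum_char,
          sum_char_mul_val]
        push_cast
        ring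

theorem tendsto_sum_legendreSym_div :
    Tendsto (fun n => ∑ i ∈ range n, (1 / ((i : ℝ) + 1)) • (legendreSym 7 (i + 1) : ℝ)) atTop
      (nhds (Real.pi / √7)) := by
  have h7 : √(7 : ℝ) ≠ 0 := by positivity
  have hdft := (continuous_im.tendsto _).comp (tendsto_sum_dft_div (legendreChar 7).map_zero)
  rw [neg_im, sum_legendreChar_seven_mul_log_im] at hdft
  have hdiv := (hdft.div_const (-√7)).comp (tendsto_add_atTop_nat 1)
  rw [neg_div_neg_eq] at hdiv
  refine hdiv.congr fun n => ?_
  have im_term (i : ℕ) : (ZMod.dft (legendreChar 7) (i : ZMod 7) / i).im =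
      -√7 * (legendreSym 7 i / i) := by
    have := legendreChar_intCast 7 i
    rw [Int.cast_natCast] at this
    rw [dft_legendreChar_seven, this, show -(I * (√7 : ℝ)) * (legendreSym 7 i : ℂ) / i =
      ((-√7 * (legendreSym 7 i / i) : ℝ) : ℂ) * I by push_cast; ring, im_ofReal_mul, I_im, mul_one]
  simp only [Function.comp_apply, im_sum, im_term]
  rw [← mul_sum, mul_div_cancel_left₀ _ (neg_ne_zero.2 h7), sum_range_succ', Nat.cast_zero,
    Nat.cast_zero, div_zero, add_zero]
  refine sum_congr rfl fun i _ => ?_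
  rw [smul_eq_mul]
  push_cast
  ring

theorem norm_sum_legendreSym_seven_le (n : ℕ) :
    ‖∑ i ∈ range n, (legendreSym 7 (i + 1) : ℝ)‖ ≤ 7 := by
  have hperiodic : Function.Periodic (fun i : ℕ => (legendreSym 7 (i + 1) : ℝ)) 7 := fun i => by
    have := legendreSym_add_mul 7 (i + 1) 1
    push_cast at this ⊢
    rw [← this]
    ring_nf
  have hsum : ∑ i ∈ range 7, legendreSym 7 ((i : ℤ) + 1) = 0 := by
    unfold legendreSym
    decide
  have hnorm (i : ℕ) : ‖(legendreSym 7 (i + 1) : ℝ)‖ ≤ 1 := by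
    simpa using norm_legendreSym_le_one 7 (i + 1)
  simpa using norm_sum_range_le_of_periodic (by norm_num) hperiodic (by exact_mod_cast hsum) hnorm n

/-! ### The diagonal -/

theorem hasDerivAt_sum_gammaQ_succ_add (M : ℕ) (y : ℝ) :
    HasDerivAt (fun y => ∑ i ∈ range M, gammaQ (i + 1) y + y) (1 - gammaQ M y) y := by
  convert! (HasDerivAt.fun_sum fun i (_ : i ∈ range M) => hasDerivAt_gammaQ_succ i y).add
    (hasDerivAt_id y) using 1
  rw [gammaQ, mul_sum, sum_neg_distrib]
  ring

theorem mul_one_sub_gammaQ_le (M : ℕ) {y : ℝ} (hy : 0 ≤ y) : M * (1 - gammaQ M y) ≤ y := by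
  have hmono : MonotoneOn (fun y => ∑ i ∈ range M, gammaQ (i + 1) y + y) (Set.Ici 0) := by
    refine monotoneOn_of_deriv_nonneg (convex_Ici 0)
      (fun y _ => (hasDerivAt_sum_gammaQ_succ_add M y).continuousAt.continuousWithinAt)
      (fun y _ => (hasDerivAt_sum_gammaQ_succ_add M y).differentiableAt.differentiableWithinAt)
      fun y hy => ?_
    rw [(hasDerivAt_sum_gammaQ_succ_add M y).deriv, sub_nonneg]
    exact gammaQ_le_one M (interior_subset hy)
  have hsum : (M : ℝ) ≤ ∑ i ∈ range M, gammaQ (i + 1) y + y := by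
    simpa [gammaQ_succ_zero] using hmono (Set.mem_Ici.2 le_rfl) (Set.mem_Ici.2 hy) hy
  have hle : ∑ i ∈ range M, gammaQ (i + 1) y ≤ M * gammaQ M y := by
    simpa using sum_le_sum fun i (hi : i ∈ range M) => gammaQ_mono hy (mem_range.1 hi)
  linarith

theorem hasSum_int_of_even {F : ℤ → ℝ} (heven : ∀ n, F (-n) = F n) (h0 : F 0 = 0) {T : ℝ}
    (hT : HasSum (fun n : ℕ => F (n + 1)) T) : HasSum F (2 * T) := by
  have hnat : HasSum (fun n : ℕ => F n) T := by
    rw [← hasSum_nat_add_iff' 1]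
    simpa [h0] using hT
  have hneg : HasSum (fun n : ℕ => F (-((n : ℤ) + 1))) T := by simpa only [heven] using hT
  exact two_mul T ▸ hnat.of_nat_of_neg_add_one hneg

/-- The contribution of `(a, 0)` to `L(1 / 2, χ ^ (4 j + 1))`, see `centralTerm_zero_right`. -/
def diagonalTerm (j : ℕ) (a : ℤ) : ℝ :=
  gammaQ (2 * j + 1) (2 * Real.pi / 7 * a ^ 2) / a * legendreSym 7 a

theorem centralTerm_zero_right (j : ℕ) (a : ℤ) : centralTerm j (a, 0) = diagonalTerm j a := by
  have heps : eps (a, 0) = legendreSym 7 a := by simp [eps_eq_legendreSym_add_four_mul]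
  have hnrm : nrm (a, 0) = a ^ 2 := by simp [nrm]
  have hlam : lam (a, 0) = a := by simp [lam]
  rw [centralTerm, diagonalTerm, heps, hnrm, hlam]
  rcases eq_or_ne a 0 with rfl | ha
  · simp
  have ha' : (a : ℂ) ≠ 0 := Int.cast_ne_zero.2 ha
  have hpow : (a : ℂ) ^ (4 * j + 1) / ((a : ℂ) ^ 2) ^ (2 * j + 1) = 1 / a := by
    field_simp
    ring
  push_cast
  rw [mul_div_assoc, hpow]
  ring

theorem summable_centralTerm_zero_right (j : ℕ) : Summable fun a : ℤ => centralTerm j (a, 0) :=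
  (hasSum_centralTerm j).summable.comp_injective (Prod.mk_left_injective 0)

theorem summable_diagonalTerm (j : ℕ) : Summable (diagonalTerm j) := by
  have h := summable_centralTerm_zero_right j
  simp_rw [centralTerm_zero_right] at h
  exact summable_ofReal.1 h

theorem summable_diagonalTerm_add_one (j : ℕ) : Summable fun n : ℕ => diagonalTerm j (n + 1) :=
  (summable_diagonalTerm j).comp_injective (i := fun n : ℕ => (n : ℤ) + 1)
    ((add_left_injective 1).comp Nat.cast_injective)

theorem hasSum_diagonalTerm (j : ℕ) :
    HasSum (diagonalTerm j) (2 * ∑' n : ℕ, diagonalTerm j (n + 1)) := by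
  refine hasSum_int_of_even (fun n => ?_) (by simp [diagonalTerm])
    (summable_diagonalTerm_add_one j).hasSum
  rw [diagonalTerm, diagonalTerm, legendreSym_seven_neg]
  push_cast
  rw [neg_sq]
  ring

theorem norm_pi_div_sqrt_seven_sub_tsum_le (j : ℕ) :
    ‖Real.pi / √7 - ∑' n : ℕ, diagonalTerm j (n + 1)‖ ≤
      28 * √(2 * Real.pi / 7 / (2 * j + 1)) := by
  have hM : (0 : ℝ) < 2 * j + 1 := by positivity
  have hy (i : ℕ) : 0 ≤ 2 * Real.pi / 7 * ((i : ℝ) + 1) ^ 2 := by positivity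
  have hsum : HasSum (fun i : ℕ => (gammaQ (2 * j + 1) (2 * Real.pi / 7 * ((i : ℝ) + 1) ^ 2) /
      (i + 1)) • (legendreSym 7 (i + 1) : ℝ)) (∑' n : ℕ, diagonalTerm j (n + 1)) := by
    convert (summable_diagonalTerm_add_one j).hasSum using 2 with i
    simp [diagonalTerm]
  refine (norm_sub_le_of_hasSum_smoothed norm_sum_legendreSym_seven_le tendsto_sum_legendreSym_div
    (fun a b hab => ?_) (fun i => gammaQ_nonneg _ (hy i)) (fun i => gammaQ_le_one _ (hy i))
    (δ := 2 * Real.pi / 7 / (2 * j + 1)) (by positivity) (fun i => ?_) hsum).trans_eq (by ring)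
  · refine antitoneOn_gammaQ_succ (2 * j) (Set.mem_Ici.2 (hy a)) (Set.mem_Ici.2 (hy b)) ?_
    gcongr
  · have h := mul_one_sub_gammaQ_le (2 * j + 1) (hy i)
    push_cast at h
    rw [div_mul_eq_mul_div (2 * Real.pi / 7), le_div_iff₀' hM]
    exact h

theorem norm_tsum_centralTerm_zero_right_sub_le (j : ℕ) :
    ‖∑' a : ℤ, centralTerm j (a, 0) - (2 * Real.pi / √7 : ℝ)‖ ≤ 56 / √(2 * j + 1) := by
  have hval : ∑' a : ℤ, centralTerm j (a, 0) =
      (2 * ∑' n : ℕ, diagonalTerm j (n + 1) : ℝ) := by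
    simp_rw [centralTerm_zero_right]
    rw [← ofReal_tsum, (hasSum_diagonalTerm j).tsum_eq]
  have hpi : 2 * Real.pi / 7 ≤ 1 := by linarith [Real.pi_lt_d2]
  calc ‖∑' a : ℤ, centralTerm j (a, 0) - (2 * Real.pi / √7 : ℝ)‖
      = 2 * ‖Real.pi / √7 - ∑' n : ℕ, diagonalTerm j (n + 1)‖ := by
        rw [hval, ← ofReal_sub, norm_real, mul_div_assoc, ← mul_sub, norm_mul, Real.norm_two,
          norm_sub_rev]
    _ ≤ 2 * (28 * √(2 * Real.pi / 7 / (2 * j + 1))) := by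
        gcongr
        exact norm_pi_div_sqrt_seven_sub_tsum_le j
    _ ≤ 2 * (28 * √(1 / (2 * j + 1))) := by gcongr
    _ = 56 / √(2 * j + 1) := by
        rw [Real.sqrt_div zero_le_one, Real.sqrt_one]
        ring

theorem sum_one_div_sqrt_le (N : ℕ) : ∑ j ∈ range N, 1 / √(2 * (j : ℝ) + 1) ≤ 2 * √N := by
  have hterm (j : ℕ) : 1 / √(2 * (j : ℝ) + 1) ≤ 2 * (√(j + 1 : ℕ) - √j) := by
    have hle : √(j + 1 : ℕ) + √j ≤ 2 * √(2 * (j : ℝ) + 1) := by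
      have h1 : √(j + 1 : ℕ) ≤ √(2 * (j : ℝ) + 1) := Real.sqrt_le_sqrt (by push_cast; linarith)
      have h2 : √(j : ℝ) ≤ √(2 * (j : ℝ) + 1) := Real.sqrt_le_sqrt (by linarith)
      linarith
    have hdiff : (√(j + 1 : ℕ) - √j) * (√(j + 1 : ℕ) + √j) = 1 := by
      rw [mul_comm, ← sq_sub_sq, Real.sq_sqrt (by positivity), Real.sq_sqrt (by positivity)]
      push_cast
      ring
    have hnonneg : 0 ≤ √(j + 1 : ℕ) - √j := sub_nonneg.2 (by gcongr; omega)
    rw [div_le_iff₀ (by positivity)]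
    linarith [mul_le_mul_of_nonneg_left hle hnonneg]
  refine (sum_le_sum fun j _ => hterm j).trans_eq ?_
  rw [← mul_sum, sum_range_sub fun j : ℕ => √(j : ℝ)]
  simp

/-! ### Cutoff weights -/

theorem mul_gammaQ_le (M : ℕ) {y : ℝ} (hy : 0 ≤ y) : y * gammaQ M y ≤ M * gammaQ (M + 1) y := by
  have hterm (j : ℕ) (hj : j ∈ range M) :
      y * (y ^ j / j.factorial) ≤ M * (y ^ (j + 1) / (j + 1).factorial) := by
    have hjM : (j : ℝ) + 1 ≤ M := by exact_mod_cast mem_range.1 hj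
    calc y * (y ^ j / j.factorial) = (j + 1) * (y ^ (j + 1) / (j + 1).factorial) := by
          rw [Nat.factorial_succ]
          push_cast
          field_simp
          ring
      _ ≤ _ := by gcongr
  rw [gammaQ, gammaQ, mul_left_comm y, mul_left_comm (M : ℝ), mul_sum, sum_range_succ']
  gcongr
  rw [mul_add, mul_sum]
  exact le_add_of_le_of_nonneg (sum_le_sum hterm) (by positivity)

theorem sq_mul_gammaQ_le (M : ℕ) {y : ℝ} (hy : 0 ≤ y) : y ^ 2 * gammaQ M y ≤ (M + 1) ^ 2 := by
  have hstep : y * gammaQ (M + 1) y ≤ M + 1 := by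
    refine (mul_gammaQ_le (M + 1) hy).trans ?_
    rw [Nat.cast_add_one]
    exact mul_le_of_le_one_right (by positivity) (gammaQ_le_one _ hy)
  calc y ^ 2 * gammaQ M y = y * (y * gammaQ M y) := by ring
    _ ≤ y * (M * gammaQ (M + 1) y) := mul_le_mul_of_nonneg_left (mul_gammaQ_le M hy) hy
    _ = M * (y * gammaQ (M + 1) y) := by ring
    _ ≤ M * (M + 1) := mul_le_mul_of_nonneg_left hstep M.cast_nonneg
    _ ≤ (M + 1) ^ 2 := by nlinarith

theorem gammaQ_le_sq_min (M : ℕ) {y : ℝ} (hy : 0 < y) : gammaQ M y ≤ min 1 ((M + 1) / y) ^ 2 := by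
  rcases min_choice 1 ((M + 1) / y) with h | h <;> rw [h]
  · rw [one_pow]
    exact gammaQ_le_one M hy.le
  · rw [div_pow, le_div_iff₀' (by positivity)]
    exact sq_mul_gammaQ_le M hy.le

/-- A weight localising to `|x| ≤ R` and decaying quadratically beyond; a product of two of these
majorises `gammaQ` along the off-diagonal. As `R ^ 2 / 0 = 0`, its value at `x = 0` is `0`. -/
def cutoff (R x : ℝ) : ℝ := min 1 (R ^ 2 / x ^ 2)

theorem cutoff_nonneg (R x : ℝ) : 0 ≤ cutoff R x := le_min zero_le_one (by positivity)

theorem cutoff_le_one (R x : ℝ) : cutoff R x ≤ 1 := min_le_left _ _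

theorem cutoff_neg (R x : ℝ) : cutoff R (-x) = cutoff R x := by rw [cutoff, neg_sq, cutoff]

theorem cutoff_zero (R : ℝ) : cutoff R 0 = 0 := by simp [cutoff]

theorem min_one_div_le_cutoff {M R x y : ℝ} (hx : x ≠ 0) (hy : 0 < y) (h : M * x ^ 2 ≤ R ^ 2 * y) :
    min 1 (M / y) ≤ cutoff R x :=
  min_le_min_left 1 ((div_le_div_iff₀ hy (by positivity)).2 h)

theorem sum_cutoff_tail_le {R : ℝ} (hR : 0 ≤ R) (n : ℕ) :
    ∑ i ∈ range n, cutoff R ((⌊R⌋₊ + i : ℕ) + 1) ≤ 2 * R := by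
  have hsq : ∑ i ∈ range n, (((⌊R⌋₊ + i : ℕ) + 1 : ℝ) ^ 2)⁻¹ ≤ 2 / (⌊R⌋₊ + 1) := by
    refine le_of_eq_of_le ?_ (sum_Ioo_inv_sq_le ⌊R⌋₊ (⌊R⌋₊ + 1 + n))
    rw [← Ico_add_one_left_eq_Ioo, sum_Ico_eq_sum_range]
    refine sum_congr (by simp) fun i _ => ?_
    push_cast
    ring_nf
  calc _ ≤ ∑ i ∈ range n, R ^ 2 * (((⌊R⌋₊ + i : ℕ) + 1 : ℝ) ^ 2)⁻¹ :=
        sum_le_sum fun i _ => min_le_right _ _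
    _ ≤ R * (⌊R⌋₊ + 1) * (2 / (⌊R⌋₊ + 1)) := by
        rw [← mul_sum, sq R]
        gcongr
        exact (Nat.lt_floor_add_one R).le
    _ = 2 * R := by
        field_simp

theorem sum_cutoff_le {R : ℝ} (hR : 0 ≤ R) (n : ℕ) : ∑ i ∈ range n, cutoff R (i + 1) ≤ 3 * R := by
  calc _ ≤ ∑ i ∈ range (⌊R⌋₊ + n), cutoff R (i + 1) :=
        sum_le_sum_of_subset_of_nonneg (range_subset_range.2 (Nat.le_add_left _ _))
          fun i _ _ => cutoff_nonneg _ _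
    _ ≤ ∑ i ∈ range ⌊R⌋₊, 1 + 2 * R := by
        rw [sum_range_add]
        exact add_le_add (sum_le_sum fun i _ => cutoff_le_one _ _) (sum_cutoff_tail_le hR n)
    _ ≤ R + 2 * R := by
        gcongr
        simpa using Nat.floor_le hR
    _ = 3 * R := by ring

theorem sum_cutoff_div_le {R : ℝ} (hR : 1 ≤ R) (n : ℕ) :
    ∑ i ∈ range n, cutoff R (i + 1) / (i + 1) ≤ 3 + Real.log R := by
  have hR0 : 0 < R := one_pos.trans_le hR
  have hharm : ∑ i ∈ range ⌊R⌋₊, 1 / ((i : ℝ) + 1) ≤ 1 + Real.log R := by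
    simpa [harmonic] using harmonic_floor_le_one_add_log R hR
  have htail : ∑ i ∈ range n, cutoff R ((⌊R⌋₊ + i : ℕ) + 1) / ((⌊R⌋₊ + i : ℕ) + 1) ≤ 2 := by
    calc _ ≤ ∑ i ∈ range n, cutoff R ((⌊R⌋₊ + i : ℕ) + 1) / R := by
          gcongr with i
          · exact cutoff_nonneg _ _
          · push_cast
            linarith [Nat.lt_floor_add_one R, (Nat.cast_nonneg i : (0 : ℝ) ≤ i)]
      _ ≤ 2 * R / R := by
          rw [← sum_div]
          gcongr
          exact sum_cutoff_tail_le hR0.le n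
      _ = 2 := mul_div_cancel_right₀ 2 hR0.ne'
  calc _ ≤ ∑ i ∈ range (⌊R⌋₊ + n), cutoff R (i + 1) / (i + 1) :=
        sum_le_sum_of_subset_of_nonneg (range_subset_range.2 (Nat.le_add_left _ _))
          fun i _ _ => div_nonneg (cutoff_nonneg _ _) (by positivity)
    _ ≤ ∑ i ∈ range ⌊R⌋₊, 1 / ((i : ℝ) + 1) + 2 := by
        rw [sum_range_add]
        gcongr
        exact cutoff_le_one _ _
    _ ≤ 3 + Real.log R := by linarith

theorem summable_and_tsum_int_le_of_even {F : ℤ → ℝ} (heven : ∀ n, F (-n) = F n) (h0 : F 0 = 0)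
    (hF : ∀ n, 0 ≤ F n) {T : ℝ} (hT : ∀ n, ∑ i ∈ range n, F (i + 1) ≤ T) :
    Summable F ∧ ∑' n, F n ≤ 2 * T := by
  have hs := summable_of_sum_range_le (fun i : ℕ => hF (i + 1)) hT
  have h := hasSum_int_of_even heven h0 hs.hasSum
  refine ⟨h.summable, h.tsum_eq.trans_le ?_⟩
  gcongr
  exact hs.tsum_le_of_sum_range_le hT

theorem summable_and_tsum_cutoff_le {R : ℝ} (hR : 0 ≤ R) :
    Summable (fun x : ℤ => cutoff R x) ∧ ∑' x : ℤ, cutoff R x ≤ 6 * R := by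
  have h := summable_and_tsum_int_le_of_even (F := fun x : ℤ => cutoff R x)
    (fun x => by rw [Int.cast_neg, cutoff_neg]) (by rw [Int.cast_zero, cutoff_zero])
    (fun x => cutoff_nonneg R x) (T := 3 * R) (by simpa using sum_cutoff_le hR)
  exact ⟨h.1, h.2.trans_eq (by ring)⟩

theorem summable_and_tsum_cutoff_div_abs_le {R : ℝ} (hR : 1 ≤ R) :
    Summable (fun x : ℤ => cutoff R x / |(x : ℝ)|) ∧
      ∑' x : ℤ, cutoff R x / |(x : ℝ)| ≤ 2 * (3 + Real.log R) := by
  refine summable_and_tsum_int_le_of_even (fun x => by rw [Int.cast_neg, cutoff_neg, abs_neg])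
    (by rw [Int.cast_zero, abs_zero, div_zero])
    (fun x => div_nonneg (cutoff_nonneg R x) (abs_nonneg _)) fun n => ?_
  refine (sum_congr rfl fun i _ => ?_).trans_le (sum_cutoff_div_le hR n)
  rw [Int.cast_add, Int.cast_natCast, Int.cast_one, abs_of_pos (by positivity)]

/-! ### The off-diagonal -/

/-- The majorant of the off-diagonal terms, in the coordinates `(b, 2 a + b)` in which the norm form
`4 N(a + b η) = (2 a + b) ^ 2 + 7 b ^ 2` is diagonal. -/
def majorant (R : ℝ) (q : ℤ × ℤ) : ℝ :=
  2 * (cutoff R q.1 / |(q.1 : ℝ)| * cutoff R q.2 + cutoff R q.1 * (cutoff R q.2 / |(q.2 : ℝ)|))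

theorem majorant_nonneg (R : ℝ) (q : ℤ × ℤ) : 0 ≤ majorant R q := by
  have h1 := cutoff_nonneg R q.1
  have h2 := cutoff_nonneg R q.2
  unfold majorant
  positivity

theorem summable_and_tsum_majorant_le {R : ℝ} (hR : 1 ≤ R) :
    Summable (majorant R) ∧ ∑' q, majorant R q ≤ 48 * (R * (3 + Real.log R)) := by
  obtain ⟨hc, hc_le⟩ := summable_and_tsum_cutoff_le (zero_le_one.trans hR)
  obtain ⟨hd, hd_le⟩ := summable_and_tsum_cutoff_div_abs_le hR
  have hc0 (x : ℤ) : 0 ≤ cutoff R x := cutoff_nonneg R x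
  have hd0 (x : ℤ) : 0 ≤ cutoff R x / |(x : ℝ)| := div_nonneg (hc0 x) (abs_nonneg _)
  have hdc := hd.hasSum.mul hc.hasSum (hd.mul_of_nonneg hc hd0 hc0)
  have hcd := hc.hasSum.mul hd.hasSum (hc.mul_of_nonneg hd hc0 hd0)
  have h : HasSum (majorant R) _ := (hdc.add hcd).mul_left 2
  refine ⟨h.summable, h.tsum_eq.trans_le ?_⟩
  have hmul := mul_le_mul hc_le hd_le (tsum_nonneg hd0) (by positivity)
  linarith

theorem gammaQ_le_cutoff_mul_cutoff {M : ℕ} {R y b c : ℝ} (hR : 5 * ((M : ℝ) + 1) ≤ R ^ 2)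
    (hb : b ≠ 0) (hc : c ≠ 0) (hby : b ^ 2 ≤ 5 * y) (hcy : c ^ 2 ≤ 5 * y) :
    gammaQ M y ≤ cutoff R b * cutoff R c := by
  have hy : 0 < y := by
    have := pow_pos (abs_pos.2 hb) 2
    rw [sq_abs] at this
    linarith
  have hle {x : ℝ} (hx : x ^ 2 ≤ 5 * y) : ((M : ℝ) + 1) * x ^ 2 ≤ R ^ 2 * y := by
    calc ((M : ℝ) + 1) * x ^ 2 ≤ (M + 1) * (5 * y) := by gcongr
      _ = 5 * (M + 1) * y := by ring
      _ ≤ R ^ 2 * y := by gcongr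
  refine (gammaQ_le_sq_min M hy).trans ?_
  rw [sq]
  exact mul_le_mul (min_one_div_le_cutoff hb hy (hle hby)) (min_one_div_le_cutoff hc hy (hle hcy))
    (by positivity) (cutoff_nonneg _ _)

theorem four_mul_nrm (p : ℤ × ℤ) :
    4 * (nrm p : ℝ) = (2 * p.1 + p.2) ^ 2 + 7 * (p.2 : ℝ) ^ 2 := by
  rw [nrm]
  push_cast
  ring

theorem gammaQ_nrm_le_cutoff_mul_cutoff {M : ℕ} {R : ℝ} (hR : 5 * ((M : ℝ) + 1) ≤ R ^ 2)
    {p : ℤ × ℤ} (hb : (p.2 : ℝ) ≠ 0) (hc : (2 * p.1 + p.2 : ℝ) ≠ 0) :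
    gammaQ M (2 * Real.pi / 7 * nrm p) ≤ cutoff R p.2 * cutoff R (2 * p.1 + p.2) := by
  have hform := four_mul_nrm p
  have hpi := mul_le_mul_of_nonneg_right Real.pi_gt_three.le
    (Int.cast_nonneg (R := ℝ) (nrm_nonneg p))
  have hb2 := sq_nonneg (p.2 : ℝ)
  have hc2 := sq_nonneg (2 * p.1 + p.2 : ℝ)
  exact gammaQ_le_cutoff_mul_cutoff hR hb hc (by linarith) (by linarith)

/-- The square of the angular component `lam p / conj (lam p)`, the ratio of the geometric
progression formed by `j ↦ centralTerm j p` without its `gammaQ` factor. -/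
def phase (p : ℤ × ℤ) : ℂ := lam p ^ 4 / (nrm p : ℂ) ^ 2

theorem norm_phase {p : ℤ × ℤ} (hp : p ≠ (0, 0)) : ‖phase p‖ = 1 := by
  have hnrm : (nrm p : ℝ) ≠ 0 := Int.cast_ne_zero.2 (nrm_pos hp).ne'
  rw [phase, norm_div, norm_pow, norm_pow, norm_intCast, sq_abs, ← norm_lam_sq, ← pow_mul]
  refine div_self ?_
  rw [pow_mul ‖lam p‖ 2 2, norm_lam_sq]
  exact pow_ne_zero 2 hnrm

theorem phase_sub_one {p : ℤ × ℤ} (hp : p ≠ (0, 0)) :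
    phase p - 1 = lam p ^ 2 * ((2 * (lam p).im : ℝ) * I) * (2 * (lam p).re : ℝ) / nrm p ^ 2 := by
  have hnrm : (nrm p : ℂ) ≠ 0 := Int.cast_ne_zero.2 (nrm_pos hp).ne'
  have hconj : lam p * starRingEnd ℂ (lam p) = nrm p := by
    rw [mul_conj, normSq_eq_norm_sq, norm_lam_sq, ofReal_intCast]
  rw [phase, ← sub_conj, ← add_conj]
  field_simp
  rw [← hconj]
  ring

theorem norm_phase_sub_one {p : ℤ × ℤ} (hp : p ≠ (0, 0)) :
    ‖phase p - 1‖ = √7 * |(2 * p.1 + p.2 : ℝ)| * |(p.2 : ℝ)| / nrm p := by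
  have hnrm : (nrm p : ℝ) ≠ 0 := Int.cast_ne_zero.2 (nrm_pos hp).ne'
  have hnorm : ‖(nrm p : ℂ)‖ = nrm p := by
    rw [norm_intCast, abs_of_nonneg (Int.cast_nonneg (nrm_nonneg p))]
  rw [phase_sub_one hp, norm_div, norm_mul, norm_mul, norm_mul, norm_pow, norm_pow, norm_lam_sq,
    hnorm, norm_I, norm_real, norm_real, lam_re, lam_im, mul_div_cancel₀ _ two_ne_zero,
    mul_div_cancel₀ _ two_ne_zero, norm_mul, Real.norm_of_nonneg (Real.sqrt_nonneg 7),
    Real.norm_eq_abs, Real.norm_eq_abs]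
  field_simp

theorem norm_lam_le (p : ℤ × ℤ) :
    ‖lam p‖ ≤ (|(2 * p.1 + p.2 : ℝ)| + √7 * |(p.2 : ℝ)|) / 2 := by
  refine (norm_le_abs_re_add_abs_im _).trans_eq ?_
  rw [lam_re, lam_im, abs_div, abs_div, abs_mul, abs_of_nonneg (Real.sqrt_nonneg 7), abs_two,
    add_div]

theorem sum_centralTerm_eq_mul_sum_smul_phase_pow {p : ℤ × ℤ} (N : ℕ) :
    ∑ j ∈ range N, centralTerm j p = eps p * (lam p / nrm p) *
      ∑ j ∈ range N, gammaQ (2 * j + 1) (2 * Real.pi / 7 * nrm p) • phase p ^ j := by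
  rw [mul_sum]
  refine sum_congr rfl fun j _ => ?_
  rw [centralTerm, phase, div_pow, ← pow_mul, ← pow_mul, pow_succ, pow_succ (nrm p : ℂ), real_smul]
  ring

theorem norm_sum_centralTerm_le_div_norm_phase_sub_one {p : ℤ × ℤ} (hp : p ≠ (0, 0))
    (hphase : phase p ≠ 1) (N : ℕ) :
    ‖∑ j ∈ range N, centralTerm j p‖ ≤ ‖lam p‖ / nrm p *
      (4 / ‖phase p - 1‖ * gammaQ (2 * N + 1) (2 * Real.pi / 7 * nrm p)) := by
  have hy : 0 ≤ 2 * Real.pi / 7 * nrm p :=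
    mul_nonneg (by positivity) (Int.cast_nonneg (nrm_nonneg p))
  have habel := norm_sum_smul_le_of_monotone (norm_geom_sum_le (norm_phase hp) hphase)
    (v := fun j => gammaQ (2 * j + 1) (2 * Real.pi / 7 * nrm p))
    (fun i j hij => gammaQ_mono hy (by omega)) (fun j => gammaQ_nonneg _ hy) N
  rw [sum_centralTerm_eq_mul_sum_smul_phase_pow, norm_mul, norm_mul, norm_div, norm_intCast (nrm p),
    abs_of_nonneg (Int.cast_nonneg (nrm_nonneg p))]
  refine mul_le_mul (mul_le_of_le_one_left ?_ (norm_eps_le_one p)) (habel.trans_eq (by ring))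
    (norm_nonneg _) ?_
  all_goals exact div_nonneg (norm_nonneg _) (Int.cast_nonneg (nrm_nonneg p))

theorem norm_sum_centralTerm_le_majorant {N : ℕ} {R : ℝ} (hR : 10 * ((N : ℝ) + 1) ≤ R ^ 2)
    {p : ℤ × ℤ} (hb : p.2 ≠ 0) :
    ‖∑ j ∈ range N, centralTerm j p‖ ≤ majorant R (p.2, 2 * p.1 + p.2) := by
  by_cases hc : 2 * p.1 + p.2 = 0
  · have heps : eps p = 0 := by rw [eps_eq_legendreSym_two_mul_add, hc, legendreSym.at_zero]
    simpa [centralTerm, heps] using majorant_nonneg R (p.2, 2 * p.1 + p.2)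
  have hp : p ≠ (0, 0) := fun h => hb (congrArg Prod.snd h)
  have hb' : (p.2 : ℝ) ≠ 0 := Int.cast_ne_zero.2 hb
  have hc' : (2 * p.1 + p.2 : ℝ) ≠ 0 := by exact_mod_cast hc
  have hnrm : (0 : ℝ) < nrm p := Int.cast_pos.2 (nrm_pos hp)
  have hnorm := norm_phase_sub_one hp
  have hphase : phase p ≠ 1 := fun h => by
    rw [h, sub_self, norm_zero] at hnorm
    exact (show (0 : ℝ) ≠ _ by positivity) hnorm
  have hgamma := gammaQ_nrm_le_cutoff_mul_cutoff (M := 2 * N + 1) (R := R)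
    (by push_cast; linarith) hb' hc'
  have h7 : 1 ≤ √(7 : ℝ) := Real.one_le_sqrt.2 (by norm_num)
  have hb0 := cutoff_nonneg R p.2
  have hc0 := cutoff_nonneg R (2 * p.1 + p.2)
  calc _ ≤ (|(2 * p.1 + p.2 : ℝ)| + √7 * |(p.2 : ℝ)|) / 2 / nrm p * (4 / ‖phase p - 1‖ *
        (cutoff R p.2 * cutoff R (2 * p.1 + p.2))) := by
        refine (norm_sum_centralTerm_le_div_norm_phase_sub_one hp hphase N).trans ?_
        refine mul_le_mul (by gcongr; exact norm_lam_le p) (by gcongr) ?_ (by positivity)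
        exact mul_nonneg (by positivity) (gammaQ_nonneg _ (by positivity))
    _ = 2 * (cutoff R p.2 / |(p.2 : ℝ)| * cutoff R (2 * p.1 + p.2) / √7 +
        cutoff R p.2 * (cutoff R (2 * p.1 + p.2) / |(2 * p.1 + p.2 : ℝ)|)) := by
        rw [hnorm]
        field_simp
        ring
    _ ≤ majorant R (p.2, 2 * p.1 + p.2) := by
        rw [majorant]
        push_cast
        gcongr
        exact div_le_self (by positivity) h7

theorem norm_tsum_sum_centralTerm_le {N : ℕ} {R : ℝ} (hR : 10 * ((N : ℝ) + 1) ≤ R ^ 2)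
    (hR1 : 1 ≤ R) :
    ‖∑' p : ({p : ℤ × ℤ | p.2 = 0}ᶜ : Set (ℤ × ℤ)), ∑ j ∈ range N, centralTerm j p‖ ≤
      48 * (R * (3 + Real.log R)) := by
  obtain ⟨hs, hs_le⟩ := summable_and_tsum_majorant_le hR1
  have hinj : Function.Injective fun p : ({p : ℤ × ℤ | p.2 = 0}ᶜ : Set (ℤ × ℤ)) =>
      ((p.1.2, 2 * p.1.1 + p.1.2) : ℤ × ℤ) := by
    rintro ⟨⟨a, b⟩, _⟩ ⟨⟨a', b'⟩, _⟩ h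
    grind
  have hs' := hs.comp_injective hinj
  refine (tsum_of_norm_bounded hs'.hasSum fun p =>
    norm_sum_centralTerm_le_majorant hR p.2).trans (le_trans ?_ hs_le)
  exact hs'.tsum_le_tsum_of_inj _ hinj (fun q _ => majorant_nonneg R q) (fun _ => le_rfl) hs

/-! ### The first moment -/

theorem norm_sum_tsum_centralTerm_zero_right_sub_le (N : ℕ) :
    ‖∑ j ∈ range N, ∑' a : ℤ, centralTerm j (a, 0) - N * (2 * Real.pi / √7 : ℝ)‖ ≤ 112 * √N := by
  calc _ = ‖∑ j ∈ range N, (∑' a : ℤ, centralTerm j (a, 0) - (2 * Real.pi / √7 : ℝ))‖ := by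
        rw [sum_sub_distrib, sum_const, card_range, nsmul_eq_mul]
    _ ≤ ∑ j ∈ range N, 56 / √(2 * (j : ℝ) + 1) :=
        norm_sum_le_of_le _ fun j _ => norm_tsum_centralTerm_zero_right_sub_le j
    _ = 56 * ∑ j ∈ range N, 1 / √(2 * (j : ℝ) + 1) := by simp only [mul_sum, mul_one_div]
    _ ≤ 56 * (2 * √N) := by
        gcongr
        exact sum_one_div_sqrt_le N
    _ = 112 * √N := by ring

theorem tsum_subtype_snd_eq_zero {E : Type*} [AddCommMonoid E] [TopologicalSpace E]
    (f : ℤ × ℤ → E) : ∑' p : ({p : ℤ × ℤ | p.2 = 0} : Set (ℤ × ℤ)), f p = ∑' a : ℤ, f (a, 0) := by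
  have hrange : {p : ℤ × ℤ | p.2 = 0} = Set.range fun a : ℤ => (a, (0 : ℤ)) := by
    ext ⟨a, b⟩
    simp [eq_comm]
  rw [hrange, tsum_range f (Prod.mk_left_injective 0)]

theorem sum_heckeL_eq_add (N : ℕ) :
    ∑ j ∈ range N, heckeL (4 * j + 1) (1 / 2) =
      ∑ j ∈ range N, ∑' a : ℤ, centralTerm j (a, 0) +
        ∑' p : ({p : ℤ × ℤ | p.2 = 0}ᶜ : Set (ℤ × ℤ)), ∑ j ∈ range N, centralTerm j p := by
  have h : HasSum (fun p => ∑ j ∈ range N, centralTerm j p)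
      (∑ j ∈ range N, heckeL (4 * j + 1) (1 / 2)) := hasSum_sum fun j _ => hasSum_centralTerm j
  rw [← Summable.tsum_finsetSum fun j _ => summable_centralTerm_zero_right j,
    ← tsum_subtype_snd_eq_zero fun p => ∑ j ∈ range N, centralTerm j p, ← h.tsum_eq]
  exact (Summable.tsum_add_tsum_compl (h.summable.subtype _) (h.summable.subtype _)).symm

theorem norm_sum_heckeL_sub_le {N : ℕ} {R : ℝ} (hR : 10 * ((N : ℝ) + 1) ≤ R ^ 2) (hR1 : 1 ≤ R) :
    ‖∑ j ∈ range N, heckeL (4 * j + 1) (1 / 2) - N * (2 * Real.pi / √7 : ℝ)‖ ≤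
      112 * √N + 48 * (R * (3 + Real.log R)) := by
  rw [sum_heckeL_eq_add, add_sub_right_comm]
  exact norm_add_le_of_le (norm_sum_tsum_centralTerm_zero_right_sub_le N)
    (norm_tsum_sum_centralTerm_le hR hR1)

theorem norm_sum_heckeL_sub_le_sqrt_mul_log {N : ℕ} (hN : 2 ≤ N) :
    ‖∑ j ∈ range N, heckeL (4 * j + 1) (1 / 2) - N * (2 * Real.pi / √7 : ℝ)‖ ≤
      2624 * (√N * Real.log N) := by
  have hN' : (2 : ℝ) ≤ N := by exact_mod_cast hN
  have hsq : √(N : ℝ) ^ 2 = N := Real.sq_sqrt N.cast_nonneg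
  have hsqrt : 1 ≤ √(N : ℝ) := Real.one_le_sqrt.2 (by linarith)
  have hlogN : 1 ≤ 2 * Real.log N := by
    linarith [Real.log_two_gt_d9, Real.log_le_log two_pos hN']
  have hlog : Real.log (5 * √N) ≤ 4 * Real.log N := by
    refine (Real.log_le_log (by positivity) ?_).trans_eq (Real.log_pow (N : ℝ) 4)
    calc 5 * √(N : ℝ) ≤ 2 ^ 3 * √N ^ 2 := by nlinarith
      _ ≤ N ^ 3 * √N ^ 2 := by gcongr
      _ = N ^ 4 := by rw [hsq, ← pow_succ]
  have hR : 10 * ((N : ℝ) + 1) ≤ (5 * √N) ^ 2 := by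
    rw [mul_pow, hsq]
    linarith
  calc _ ≤ 112 * √(N : ℝ) + 48 * (5 * √N * (3 + Real.log (5 * √N))) :=
        norm_sum_heckeL_sub_le hR (by linarith)
    _ ≤ 112 * (√N * (2 * Real.log N)) + 48 * (5 * √N * (10 * Real.log N)) := by
        gcongr
        · exact le_mul_of_one_le_right (Real.sqrt_nonneg _) hlogN
        · linarith
    _ = 2624 * (√N * Real.log N) := by ring

theorem firstMoment_eq_sum_range (N : ℕ) :
    firstMoment N = 1 / (N : ℂ) * ∑ j ∈ range N, heckeL (4 * j + 1) (1 / 2) := by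
  rw [firstMoment, ← Finset.Ico_add_one_right_eq_Icc, sum_Ico_eq_sum_range, Nat.add_sub_cancel]
  refine congrArg _ (sum_congr rfl fun j _ => ?_)
  congr 1
  omega

theorem firstMoment_sub_isBigO :
    (fun N : ℕ => firstMoment N - ((2 * Real.pi / √7 : ℝ) : ℂ)) =O[atTop]
      (fun N : ℕ => Real.log (N : ℝ) / √(N : ℝ)) := by
  refine IsBigO.of_bound 2624 ?_
  filter_upwards [eventually_ge_atTop 2] with N hN
  have hN0 : (N : ℂ) ≠ 0 := Nat.cast_ne_zero.2 (by omega)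
  calc ‖firstMoment N - (2 * Real.pi / √7 : ℝ)‖ = ‖∑ j ∈ range N, heckeL (4 * j + 1) (1 / 2) -
        N * (2 * Real.pi / √7 : ℝ)‖ / N := by
        rw [firstMoment_eq_sum_range, ← norm_natCast, ← norm_div, sub_div,
          mul_div_cancel_left₀ _ hN0, one_div_mul_eq_div]
    _ ≤ 2624 * (√N * Real.log N) / N := by
        gcongr
        exact norm_sum_heckeL_sub_le_sqrt_mul_log hN
    _ = 2624 * (Real.log N / √N) := by
        rw [mul_comm √_, mul_div_assoc, mul_div_assoc, Real.sqrt_div_self', mul_one_div]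
    _ ≤ 2624 * ‖Real.log N / √N‖ := by
        gcongr
        exact Real.le_norm_self _

end HeckeSeven

end

theorem theorem1 :
    (∀ n : ℕ, 1 ≤ n → HeckeSeven.IsHeckeL (4 * n - 3) (HeckeSeven.heckeL (4 * n - 3))) ∧
      (fun N : ℕ => HeckeSeven.firstMoment N - ((2 * Real.pi / √7 : ℝ) : ℂ)) =O[atTop]
        (fun N : ℕ => Real.log (N : ℝ) / √(N : ℝ)) := by
  refine ⟨fun n hn => HeckeSeven.isHeckeL_heckeL ?_, HeckeSeven.firstMoment_sub_isBigO⟩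
  exact ⟨2 * (n - 1), by omega⟩
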